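/- Consider a Sturm–Liouville problem with a transfer condition, given by data $(S,q,M,\alpha,\beta)$ with $S>0$, $q\in L^2[-S,S]$ real-valued, $M$ a real $2\times 2$ matrix with $\det M=1$, $\alpha\in[0,\pi)$ and $\beta\in(0,\pi]$: $$-y''+q(x)y=\lambda y\ \text{ on } [-S,0)\cup(0,S],\qquad \begin{bmatrix}y(0^+)\\ y'(0^+)\end{bmatrix}=M\begin{bmatrix}y(0^-)\\ y'(0^-)\end{bmatrix},$$ $$y(-S)\cos\alpha-y'(-S)\sin\alpha=0,\qquad y(S)\cos\beta-y'(S)\sin\beta=0 .$$ For $\lambda\in\mathbb C$ let $u_\alpha(\cdot,\lambda)$ and $w_\alpha(\cdot,\lambda)$ be the solutions of the differential equation and the transfer condition with $u_\alpha(-S)=\cos\alpha$, $u_\alpha'(-S)=-\sin\alpha$, $w_\alpha(-S)=\sin\alpha$, $w_\alpha'(-S)=\cos\alpha$. For $\lambda$ not an eigenvalue of the problem, the value $m_{\alpha,\beta}(\lambda)$ of the Titchmarsh–Weyl $m$-function is the unique complex number for which $u_\alpha+m_{\alpha,\beta}(\lambda)\,w_\alpha$ satisfies the boundary condition at $S$.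 The norming constant of an eigenvalue $\lambda_n$ is $a_n=\int_{-S}^{S}w_\alpha(x,\lambda_n)^2\,dx$. For $\alpha\neq 0$, the eigenvalues $\lambda_0<\lambda_1<\lambda_2<\cdots$ together with the corresponding norming constants $(a_n)$ uniquely determine the $m$-function $m_{\alpha,\beta}$. That is: if two such problems, with data $(S,q,M,\alpha,\beta)$ and $(\tilde S,\tilde q,\tilde M,\tilde\alpha,\tilde\beta)$ and with $\alpha\neq 0$, $\tilde\alpha\neq 0$, have the same eigenvalues and, at each eigenvalue, the same norming constant, then $m_{\alpha,\beta}(\lambda)$ and $\tilde m_{\tilde\alpha,\tilde\beta}(\lambda)$ are well defined and equal for every $\lambda\in\mathbb C$ that is not an eigenvalue. -/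

import Mathlib

open MeasureTheory Set

/-- The Sturm–Liouville problem `-y'' + q y = λ y` on `[-S, S]` with a transfer condition
`(y(0⁺), y'(0⁺))ᵀ = M (y(0⁻), y'(0⁻))ᵀ` at the origin and separated boundary conditions
`y(-S) cos α - y'(-S) sin α = 0`, `y(S) cos β - y'(S) sin β = 0`: its data and the standing
assumptions on them. -/
structure TransferProblem where
  /-- half-length of the interval -/
  S : ℝ
  /-- the real potential (only its restriction to `[-S, S]` matters) -/
  q : ℝ → ℝ
  /-- the real transfer matrix -/
  M : Matrix (Fin 2) (Fin 2) ℝ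
  /-- angle of the initial boundary condition -/
  α : ℝ
  /-- angle of the terminal boundary condition -/
  β : ℝ
  S_pos : 0 < S
  q_memLp : MemLp q 2 (volume.restrict (Icc (-S) S))
  det_M : M.det = 1
  α_mem : α ∈ Ico 0 Real.pi
  β_mem : β ∈ Ioc 0 Real.pi

/-- A complex function `y` on `[-S, 0) ∪ (0, S]` together with its derivative, given through the
extensions of `y|[-S,0)`, `y'|[-S,0)` to `[-S, 0]` (`left`, `dleft`) and of `y|(0,S]`, `y'|(0,S]`
to `[0, S]` (`right`, `dright`). Thus `left 0 = y(0⁻)`, `dleft 0 = y'(0⁻)`, `right 0 = y(0⁺)`,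
`dright 0 = y'(0⁺)`. -/
structure BrokenFun where
  left : ℝ → ℂ
  dleft : ℝ → ℂ
  right : ℝ → ℂ
  dright : ℝ → ℂ

/-- `y` solves `-y'' + q y = lam y` on `[a, b]` in the Carathéodory sense, with derivative `z`:
`y' = z` on `[a, b]`, and `z` is a primitive of `(q - lam) y` (so `z` is absolutely continuous and
`z' = (q - lam) y` almost everywhere). -/
def SolvesOn (q : ℝ → ℝ) (lam : ℂ) (a b : ℝ) (y z : ℝ → ℂ) : Prop :=
  (∀ x ∈ Icc a b, HasDerivWithinAt y (z x) (Icc a b) x) ∧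
  ∀ x ∈ Icc a b, z x = z a + ∫ t in a..x, ((q t : ℂ) - lam) * y t

namespace TransferProblem

/-- `y` solves the differential equation with spectral parameter `lam` on both sides of the origin
and satisfies the transfer condition at the origin. -/
def IsSolution (P : TransferProblem) (lam : ℂ) (y : BrokenFun) : Prop :=
  SolvesOn P.q lam (-P.S) 0 y.left y.dleft ∧
  SolvesOn P.q lam 0 P.S y.right y.dright ∧
  y.right 0 = (P.M 0 0 : ℂ) * y.left 0 + (P.M 0 1 : ℂ) * y.dleft 0 ∧
  y.dright 0 = (P.M 1 0 : ℂ) * y.left 0 + (P.M 1 1 : ℂ) * y.dleft 0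

/-- The solution `u_α(·, lam)`: `u(-S) = cos α`, `u'(-S) = -sin α`. -/
def IsU (P : TransferProblem) (lam : ℂ) (u : BrokenFun) : Prop :=
  P.IsSolution lam u ∧ u.left (-P.S) = (Real.cos P.α : ℂ) ∧ u.dleft (-P.S) = -(Real.sin P.α : ℂ)

/-- The solution `w_α(·, lam)`: `w(-S) = sin α`, `w'(-S) = cos α`. -/
def IsW (P : TransferProblem) (lam : ℂ) (w : BrokenFun) : Prop :=
  P.IsSolution lam w ∧ w.left (-P.S) = (Real.sin P.α : ℂ) ∧ w.dleft (-P.S) = (Real.cos P.α : ℂ)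

/-- `lam` is an eigenvalue: there is a nontrivial solution satisfying both boundary conditions. -/
def IsEigenvalue (P : TransferProblem) (lam : ℂ) : Prop :=
  ∃ y : BrokenFun, P.IsSolution lam y ∧
    ((∃ x ∈ Icc (-P.S) 0, y.left x ≠ 0) ∨ (∃ x ∈ Icc 0 P.S, y.right x ≠ 0)) ∧
    y.left (-P.S) * (Real.cos P.α : ℂ) - y.dleft (-P.S) * (Real.sin P.α : ℂ) = 0 ∧
    y.right P.S * (Real.cos P.β : ℂ) - y.dright P.S * (Real.sin P.β : ℂ) = 0

/-- `a = ∫_{-S}^{S} w_α(x, lam)² dx`, the norming constant when `lam` is an eigenvalue. -/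
def IsNormingConstant (P : TransferProblem) (lam a : ℂ) : Prop :=
  ∃ w : BrokenFun, P.IsW lam w ∧
    a = (∫ x in (-P.S)..0, w.left x ^ 2) + ∫ x in (0 : ℝ)..P.S, w.right x ^ 2

/-- `z` is a number for which `u_α(·, lam) + z w_α(·, lam)` satisfies the terminal boundary
condition at `S`. -/
def IsWeylValue (P : TransferProblem) (lam z : ℂ) : Prop :=
  ∃ u w : BrokenFun, P.IsU lam u ∧ P.IsW lam w ∧
    (u.right P.S + z * w.right P.S) * (Real.cos P.β : ℂ) -
      (u.dright P.S + z * w.dright P.S) * (Real.sin P.β : ℂ) = 0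

/-- `m` is the Titchmarsh–Weyl `m`-function `m_{α,β}`: for every complex `lam` that is not an
eigenvalue, `m lam` is the one and only value `z` for which `u_α + z w_α` satisfies the terminal
boundary condition. (At the eigenvalues the `m`-function has poles and no value is prescribed.) -/
def IsWeylFunction (P : TransferProblem) (m : ℂ → ℂ) : Prop :=
  ∀ lam : ℂ, ¬ P.IsEigenvalue lam → ∀ z : ℂ, P.IsWeylValue lam z ↔ z = m lam

end TransferProblem

/-! Let `charU` and `charW` be the terminal boundary forms of u_α and w_α. They are entire in λ, the
eigenvalues are the zeros of `charW`, and m = -`charU`/`charW`. Lagrange's identity, carried across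
the origin by det M = 1, gives `charW`'(μ) = a · `charU`(μ) at an eigenvalue μ with norming constant
a (`hasDerivAt_charW`). Both factors are nonzero, so m has a simple pole with residue -1/a. Equal
spectra and norming constants therefore make the difference E of the two m-functions entire
(`exists_entire_eq_sub`).

For the Weyl solution ψ = u_α + m w_α one has Im m(λ) = Im λ · ‖ψ‖², and m(λ) - m(i) is (λ - i)
times the pairing of two Weyl solutions. Together these give |m(λ)| |Im λ| ≤ C |λ|² for |λ| ≥ 1
(`exists_norm_weyl_mul_le`), and a maximum-principle argument followed by Liouville's theorem makes
E affine.

The two remaining coefficients are found on the ray λ = 2ir² = -k², k = r(1 - i), where 1/(m + cot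
α) = sin α cos α + k sin² α + o(1) (`tendsto_weyl_asymptotics`). Hence m → -cot α, so E is the
constant difference of the cotangents and m + cot α is the same function for both problems on the
ray. Comparing the expansions of its reciprocal shows that sin² α and sin α cos α agree; thus the
cotangents agree and E = 0. The expansion rests on estimates over [-S, 0]; the rest of the problem
enters only through the sign of Im(ψ' ψ̄) there. -/

/-! ### Primitives of integrable complex functions -/

/-- `F` is a primitive on `[a, b]` of the integrable function `f`. -/
structure IsPrimitiveOn (F f : ℝ → ℂ) (a b : ℝ) : Prop where
  intervalIntegrable : IntervalIntegrable f volume a b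
  eq_add : ∀ x ∈ Icc a b, F x = F a + ∫ t in a..x, f t

namespace IsPrimitiveOn

variable {F G f g : ℝ → ℂ} {a b : ℝ}

/-- Each increment is dominated by the increment of the primitive of ‖f‖, which reduces the claim to
the real case. -/
theorem absolutelyContinuousOnInterval_integral (hf : IntervalIntegrable f volume a b) :
    AbsolutelyContinuousOnInterval (fun x => ∫ t in a..x, f t) a b := by
  have h := hf.norm.absolutelyContinuousOnInterval_intervalIntegral (c := a) (by simp)
  unfold AbsolutelyContinuousOnInterval at h ⊢
  refine squeeze_zero' (.of_forall fun _ => Finset.sum_nonneg fun i _ => dist_nonneg) ?_ h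
  rw [Filter.eventually_inf_principal]
  refine .of_forall fun ⟨n, I⟩ hnI => Finset.sum_le_sum fun i hi => ?_
  obtain ⟨h1, h2⟩ := hnI.left i hi
  have i1 : IntervalIntegrable f volume a (I i).1 :=
    hf.mono_set (uIcc_subset_uIcc left_mem_uIcc h1)
  have i2 : IntervalIntegrable f volume a (I i).2 :=
    hf.mono_set (uIcc_subset_uIcc left_mem_uIcc h2)
  rw [dist_eq_norm, dist_eq_norm, intervalIntegral.integral_interval_sub_left i1 i2,
    intervalIntegral.integral_interval_sub_left i1.norm i2.norm, Real.norm_eq_abs]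
  exact intervalIntegral.norm_integral_le_abs_integral_norm

theorem absolutelyContinuousOnInterval (h : IsPrimitiveOn F f a b) (hab : a ≤ b) :
    AbsolutelyContinuousOnInterval F a b := by
  have h0 := absolutelyContinuousOnInterval_integral h.intervalIntegrable
  unfold AbsolutelyContinuousOnInterval at h0 ⊢
  refine h0.congr' ?_
  rw [Filter.EventuallyEq, Filter.eventually_inf_principal]
  refine .of_forall fun ⟨n, I⟩ hnI => Finset.sum_congr rfl fun i hi => ?_
  obtain ⟨h1, h2⟩ := hnI.left i hi
  rw [uIcc_of_le hab] at h1 h2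
  rw [h.eq_add _ h1, h.eq_add _ h2, dist_add_left]

theorem continuousOn (h : IsPrimitiveOn F f a b) (hab : a ≤ b) : ContinuousOn F (Icc a b) := by
  simpa [uIcc_of_le hab] using (h.absolutelyContinuousOnInterval hab).continuousOn

theorem ae_hasDerivAt (h : IsPrimitiveOn F f a b) (hab : a ≤ b) :
    ∀ᵐ x, x ∈ uIcc a b → HasDerivAt F (f x) x := by
  filter_upwards [h.intervalIntegrable.ae_hasDerivAt_integral,
    compl_mem_ae_iff.2 (measure_singleton a),
    compl_mem_ae_iff.2 (measure_singleton b)] with x hx hxa hxb hxm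
  have h1 := (hx hxm a left_mem_uIcc).const_add (F a)
  refine h1.congr_of_eventuallyEq ?_
  rw [uIcc_of_le hab] at hxm
  have : Ioo a b ∈ nhds x :=
    Ioo_mem_nhds (lt_of_le_of_ne hxm.1 (Ne.symm hxa)) (lt_of_le_of_ne hxm.2 hxb)
  filter_upwards [this] with y hy
  exact h.eq_add y ⟨hy.1.le, hy.2.le⟩

/-- The difference from the integral of f is absolutely continuous with derivative zero almost
everywhere, hence constant. -/
theorem of_ae_hasDerivAt (hF : AbsolutelyContinuousOnInterval F a b) (hab : a ≤ b)
    (hf : IntervalIntegrable f volume a b) (h : ∀ᵐ x, x ∈ uIcc a b → HasDerivAt F (f x) x) :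
    IsPrimitiveOn F f a b := by
  refine ⟨hf, fun x hx => ?_⟩
  have hac : AbsolutelyContinuousOnInterval (fun x => F x - ∫ t in a..x, f t) a b :=
    hF.fun_sub (absolutelyContinuousOnInterval_integral hf)
  obtain ⟨C, hC⟩ := hac.const_of_ae_hasDerivAt_zero (by
    filter_upwards [h, hf.ae_hasDerivAt_integral] with x h1 h2 h3
    simpa using (h1 h3).fun_sub (h2 h3 a left_mem_uIcc))
  rw [uIcc_of_le hab] at hC
  have h1 := hC x hx
  have h2 := hC a (left_mem_Icc.2 hab)
  simp only [intervalIntegral.integral_same, sub_zero] at h1 h2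
  rw [h2, ← h1]; ring

/-- This product rule is what Lagrange's identity needs: with q only integrable, y' has a derivative
only almost everywhere. -/
theorem mul (hF : IsPrimitiveOn F f a b) (hG : IsPrimitiveOn G g a b) (hab : a ≤ b) :
    IsPrimitiveOn (fun x => F x * G x) (fun x => f x * G x + F x * g x) a b := by
  refine of_ae_hasDerivAt
    ((hF.absolutelyContinuousOnInterval hab).fun_smul (hG.absolutelyContinuousOnInterval hab)) hab
    ?_ ?_
  · refine (hF.intervalIntegrable.mul_continuousOn ?_).add
      (hG.intervalIntegrable.continuousOn_mul ?_)
    · rw [uIcc_of_le hab]; exact hG.continuousOn hab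
    · rw [uIcc_of_le hab]; exact hF.continuousOn hab
  · filter_upwards [hF.ae_hasDerivAt hab, hG.ae_hasDerivAt hab] with x h1 h2 hx
    exact (h1 hx).fun_mul (h2 hx)

theorem sub_eq (hF : IsPrimitiveOn F f a b) (hab : a ≤ b) {x y : ℝ} (hx : x ∈ Icc a b)
    (hy : y ∈ Icc a b) : F y - F x = ∫ t in x..y, f t := by
  have hi : ∀ x ∈ Icc a b, IntervalIntegrable f volume a x := fun x hx =>
    hF.intervalIntegrable.mono_set (uIcc_subset_uIcc left_mem_uIcc (by rwa [uIcc_of_le hab]))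
  rw [hF.eq_add x hx, hF.eq_add y hy,
    ← intervalIntegral.integral_interval_sub_left (hi y hy) (hi x hx)]
  ring

theorem add (hF : IsPrimitiveOn F f a b) (hG : IsPrimitiveOn G g a b) (hab : a ≤ b) :
    IsPrimitiveOn (fun x => F x + G x) (fun x => f x + g x) a b := by
  refine ⟨hF.intervalIntegrable.add hG.intervalIntegrable, fun x hx => ?_⟩
  have hs : uIcc a x ⊆ uIcc a b := uIcc_subset_uIcc left_mem_uIcc (by rwa [uIcc_of_le hab])
  rw [intervalIntegral.integral_add (hF.intervalIntegrable.mono_set hs)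
    (hG.intervalIntegrable.mono_set hs), hF.eq_add x hx, hG.eq_add x hx]
  ring

theorem const_mul (hF : IsPrimitiveOn F f a b) (k : ℂ) :
    IsPrimitiveOn (fun x => k * F x) (fun x => k * f x) a b := by
  refine ⟨hF.intervalIntegrable.const_mul k, fun x hx => ?_⟩
  rw [intervalIntegral.integral_const_mul, hF.eq_add x hx]
  ring

theorem conj (hF : IsPrimitiveOn F f a b) :
    IsPrimitiveOn (fun x => (starRingEnd ℂ) (F x)) (fun x => (starRingEnd ℂ) (f x)) a b := by
  refine ⟨?_, fun x hx => ?_⟩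
  · have := hF.intervalIntegrable
    rw [intervalIntegrable_iff] at this ⊢
    exact Complex.conjCLE.toContinuousLinearMap.integrable_comp this
  · rw [intervalIntegral.intervalIntegral_conj, hF.eq_add x hx, map_add]

theorem of_hasDerivWithinAt (hab : a ≤ b) (h : ∀ x ∈ Icc a b, HasDerivWithinAt F (f x) (Icc a b) x)
    (hf : ContinuousOn f (Icc a b)) : IsPrimitiveOn F f a b := by
  have hi : IntervalIntegrable f volume a b :=
    (by rwa [uIcc_of_le hab] : ContinuousOn f (uIcc a b)).intervalIntegrable
  refine ⟨hi, fun x hx => ?_⟩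
  rw [intervalIntegral.integral_eq_sub_of_hasDeriv_right_of_le hx.1 (f := F) (f' := f)]
  · ring
  · exact fun y hy => ((h y ⟨hy.1, hy.2.trans hx.2⟩).continuousWithinAt).mono
      (Icc_subset_Icc_right hx.2)
  · intro y hy
    exact ((h y ⟨hy.1.le, hy.2.le.trans hx.2⟩).hasDerivAt
      (Icc_mem_nhds hy.1 (hy.2.trans_le hx.2))).hasDerivWithinAt
  · exact hi.mono_set (uIcc_subset_uIcc left_mem_uIcc (by rwa [uIcc_of_le hab]))

end IsPrimitiveOn

/-! ### Volterra operators and their invertibility -/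

theorem isUnit_one_sub_of_norm_conj_lt_one {R : Type*} [NormedRing R] [HasSummableGeomSeries R]
    {e e' T : R} (hee' : e * e' = 1) (he'e : e' * e = 1) (h : ‖e * T * e'‖ < 1) :
    IsUnit (1 - T) := by
  have hu : IsUnit (1 - e * T * e') := isUnit_one_sub_of_norm_lt_one h
  have he : IsUnit e := ⟨⟨e, e', hee', he'e⟩, rfl⟩
  have he' : IsUnit e' := ⟨⟨e', e, he'e, hee'⟩, rfl⟩
  have : 1 - T = e' * (1 - e * T * e') * e := by
    rw [mul_sub, sub_mul, mul_one, he'e]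
    simp only [mul_assoc, he'e, mul_one]
    rw [← mul_assoc, he'e, one_mul]
  rw [this]
  exact (he'.mul hu).mul he

section Volterra

variable {a b : ℝ}

theorem intervalIntegrable_mul_IccExtend (hab : a ≤ b) {p : ℝ → ℂ}
    (hp : IntervalIntegrable p volume a b) (f : C(Icc a b, ℂ)) :
    IntervalIntegrable (fun t => p t * IccExtend hab f t) volume a b :=
  hp.mul_continuousOn (f.continuous.Icc_extend' (h := hab)).continuousOn

theorem continuousOn_integral_mul_IccExtend (hab : a ≤ b) {p : ℝ → ℂ}
    (hp : IntervalIntegrable p volume a b) (f : C(Icc a b, ℂ)) :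
    ContinuousOn (fun x => ∫ t in a..x, p t * IccExtend hab f t) (Icc a b) := by
  have h := IsPrimitiveOn.absolutelyContinuousOnInterval_integral
    (intervalIntegrable_mul_IccExtend hab hp f)
  simpa [uIcc_of_le hab] using h.continuousOn

theorem continuous_integral_mul_IccExtend (hab : a ≤ b) {p : ℝ → ℂ}
    (hp : IntervalIntegrable p volume a b) (f : C(Icc a b, ℂ)) :
    Continuous fun x : Icc a b => ∫ t in a..x, p t * IccExtend hab f t :=
  (continuousOn_integral_mul_IccExtend hab hp f).domRestrict

/-- A pointwise bound for the primitive of `p f` against a nonnegative weight. -/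
theorem norm_integral_mul_IccExtend_le (hab : a ≤ b) {p : ℝ → ℂ}
    (hp : IntervalIntegrable p volume a b) (f : C(Icc a b, ℂ)) {x B : ℝ} (hx : x ∈ Icc a b)
    (hB : ∀ t (ht : t ∈ Icc a b), t ≤ x → ‖f ⟨t, ht⟩‖ ≤ B) :
    ‖∫ t in a..x, p t * IccExtend hab f t‖ ≤ (∫ t in a..b, ‖p t‖) * B := by
  have hs : uIcc a x ⊆ uIcc a b := uIcc_subset_uIcc left_mem_uIcc (by rwa [uIcc_of_le hab])
  have hB0 : 0 ≤ B := (norm_nonneg _).trans (hB a (left_mem_Icc.2 hab) hx.1)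
  calc ‖∫ t in a..x, p t * IccExtend hab f t‖
      ≤ ∫ t in a..x, ‖p t‖ * B := by
        refine intervalIntegral.norm_integral_le_of_norm_le hx.1 (.of_forall fun t ht => ?_)
          ((hp.mono_set hs).norm.mul_const B)
        have htm : t ∈ Icc a b := ⟨ht.1.le, ht.2.trans hx.2⟩
        rw [norm_mul, IccExtend_of_mem hab _ htm]
        gcongr
        exact hB t htm ht.2
    _ = (∫ t in a..x, ‖p t‖) * B := intervalIntegral.integral_mul_const _ _
    _ ≤ (∫ t in a..b, ‖p t‖) * B := by
        gcongr
        exact intervalIntegral.integral_mono_interval le_rfl hx.1 hx.2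
          (.of_forall fun t => norm_nonneg _) hp.norm

/-- The function `x ↦ ∫ t in a..x, p t * f t` on `[a, b]`. -/
noncomputable def volterraFun (hab : a ≤ b) (p : ℝ → ℂ) (hp : IntervalIntegrable p volume a b)
    (f : C(Icc a b, ℂ)) : C(Icc a b, ℂ) :=
  ⟨fun x => ∫ t in a..x, p t * IccExtend hab f t, continuous_integral_mul_IccExtend hab hp f⟩

/-- The Volterra operator `f ↦ (x ↦ ∫ t in a..x, p t * f t)` on `C([a, b])`. -/
noncomputable def volterra (hab : a ≤ b) (p : ℝ → ℂ) (hp : IntervalIntegrable p volume a b) :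
    C(Icc a b, ℂ) →L[ℂ] C(Icc a b, ℂ) :=
  LinearMap.mkContinuous
    { toFun := volterraFun hab p hp
      map_add' := fun f g => by
        ext x
        have hs : uIcc a (x : ℝ) ⊆ uIcc a b :=
          uIcc_subset_uIcc left_mem_uIcc (by rw [uIcc_of_le hab]; exact x.2)
        change ∫ t in a..x, p t * IccExtend hab (f + g) t =
          (∫ t in a..x, p t * IccExtend hab f t) + ∫ t in a..x, p t * IccExtend hab g t
        rw [← intervalIntegral.integral_add
          ((intervalIntegrable_mul_IccExtend hab hp f).mono_set hs)
          ((intervalIntegrable_mul_IccExtend hab hp g).mono_set hs)]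
        simp [IccExtend, mul_add]
      map_smul' := fun c f => by
        ext x
        change ∫ t in a..x, p t * IccExtend hab (c • f) t =
          c * ∫ t in a..x, p t * IccExtend hab f t
        rw [← intervalIntegral.integral_const_mul]
        simp [IccExtend, mul_left_comm] }
    (∫ t in a..b, ‖p t‖) fun f => by
      refine (ContinuousMap.norm_le _ (mul_nonneg
        (intervalIntegral.integral_nonneg hab fun _ _ => norm_nonneg _) (norm_nonneg _))).2 ?_
      intro x
      exact norm_integral_mul_IccExtend_le hab hp f x.2 fun t ht _ => f.norm_coe_le_norm _

theorem volterra_apply (hab : a ≤ b) {p : ℝ → ℂ} (hp : IntervalIntegrable p volume a b)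
    (f : C(Icc a b, ℂ)) (x : Icc a b) :
    volterra hab p hp f x = ∫ t in a..x, p t * IccExtend hab f t := rfl

/-- The integral operator of the Cauchy problem for `y'' = p y`. -/
noncomputable def doubleVolterra (hab : a ≤ b) (p : ℝ → ℂ) (hp : IntervalIntegrable p volume a b) :
    C(Icc a b, ℂ) →L[ℂ] C(Icc a b, ℂ) :=
  volterra hab (fun _ => 1) intervalIntegrable_const * volterra hab p hp

/-- The function `x ↦ exp (k (x - a))` on `[a, b]`. -/
noncomputable def expWeight (a b k : ℝ) : C(Icc a b, ℂ) :=
  ⟨fun x => Complex.exp (k * ((x : ℝ) - a : ℝ)), by fun_prop⟩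

theorem norm_expWeight (k : ℝ) (x : Icc a b) :
    ‖expWeight a b k x‖ = Real.exp (k * (x - a)) := by
  simp [expWeight, Complex.norm_exp]

theorem expWeight_mul_neg (k : ℝ) : expWeight a b k * expWeight a b (-k) = 1 := by
  ext x
  simp [expWeight, ← Complex.exp_add]

/-- Integrating an exponential of rate k gains a factor 1/k; this makes the iterated operator a
contraction in a weighted norm. -/
theorem norm_integral_mul_exp_le (hab : a ≤ b) {k : ℝ} (hk : 0 < k) (g : C(Icc a b, ℂ)) {A : ℝ}
    (hA : 0 ≤ A) (hg : ∀ t : Icc a b, ‖g t‖ ≤ A * Real.exp (k * (t - a))) (x : Icc a b) :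
    ‖volterra hab (fun _ => 1) intervalIntegrable_const g x‖ ≤
      A / k * Real.exp (k * (x - a)) := by
  rw [volterra_apply]
  have hd : ∀ t ∈ uIcc a (x : ℝ), HasDerivAt (fun t => A / k * Real.exp (k * (t - a)))
      (A * Real.exp (k * (t - a))) t := fun t _ => by
    have h1 : HasDerivAt (fun t : ℝ => k * (t - a)) (k * 1) t :=
      ((hasDerivAt_id t).sub_const a).const_mul k
    convert! (h1.exp.const_mul (A / k)) using 1
    field_simp
  have hi : IntervalIntegrable (fun t => A * Real.exp (k * (t - a))) volume a x :=
    Continuous.intervalIntegrable (by fun_prop) _ _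
  calc _ ≤ ∫ t in a..x, A * Real.exp (k * (t - a)) := by
        refine intervalIntegral.norm_integral_le_of_norm_le x.2.1 (.of_forall fun t ht => ?_) hi
        have htm : t ∈ Icc a b := ⟨ht.1.le, ht.2.trans x.2.2⟩
        rw [one_mul, IccExtend_of_mem hab _ htm]
        exact hg ⟨t, htm⟩
    _ = A / k * Real.exp (k * (x - a)) - A / k := by
        rw [intervalIntegral.integral_eq_sub_of_hasDerivAt hd hi]; simp
    _ ≤ _ := sub_le_self _ (by positivity)

/-- Conjugation by exp(k(x - a)) amounts to using an exponentially weighted sup norm. The inner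
integral costs the L¹ norm Q of p and the outer one gains 1/k, so the conjugated norm is at most
Q/k. -/
theorem isUnit_one_sub_doubleVolterra (hab : a ≤ b) {p : ℝ → ℂ}
    (hp : IntervalIntegrable p volume a b) : IsUnit (1 - doubleVolterra hab p hp) := by
  set Q := ∫ t in a..b, ‖p t‖
  have hQ : 0 ≤ Q := intervalIntegral.integral_nonneg hab fun _ _ => norm_nonneg _
  -- Any positive k greater than Q would do.
  set k : ℝ := 2 * Q + 1
  have hk : 0 < k := by positivity
  set e : C(Icc a b, ℂ) →L[ℂ] C(Icc a b, ℂ) := ContinuousLinearMap.mul ℂ _ (expWeight a b (-k))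
  set e' : C(Icc a b, ℂ) →L[ℂ] C(Icc a b, ℂ) := ContinuousLinearMap.mul ℂ _ (expWeight a b k)
  have hee' : e * e' = 1 := by
    ext1 f
    change expWeight a b (-k) * (expWeight a b k * f) = f
    rw [← mul_assoc, mul_comm (expWeight a b (-k)), expWeight_mul_neg, one_mul]
  have he'e : e' * e = 1 := by
    ext1 f
    change expWeight a b k * (expWeight a b (-k) * f) = f
    rw [← mul_assoc, expWeight_mul_neg, one_mul]
  set T := doubleVolterra hab p hp
  have hnorm : ‖e * T * e'‖ < 1 := by
    refine lt_of_le_of_lt (ContinuousLinearMap.opNorm_le_bound _ (M := Q / k) (by positivity)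
      fun f => ?_) (by rw [div_lt_one hk]; linarith)
    refine (ContinuousMap.norm_le _ (by positivity)).2 fun x => ?_
    change ‖expWeight a b (-k) x * volterra hab (fun _ => 1) intervalIntegrable_const
      (volterra hab p hp (expWeight a b k * f)) x‖ ≤ _
    rw [norm_mul, norm_expWeight]
    have h1 : ∀ t : Icc a b, ‖volterra hab p hp (expWeight a b k * f) t‖ ≤
        (Q * ‖f‖) * Real.exp (k * (t - a)) := fun t => by
      rw [volterra_apply, mul_assoc, mul_comm ‖f‖]
      refine norm_integral_mul_IccExtend_le hab hp _ t.2 fun s hs hst => ?_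
      rw [ContinuousMap.mul_apply, norm_mul, norm_expWeight]
      gcongr
      exact f.norm_coe_le_norm _
    have h2 := norm_integral_mul_exp_le hab hk _ (by positivity) h1 x
    calc _ ≤ Real.exp (-k * (x - a)) * (Q * ‖f‖ / k * Real.exp (k * (x - a))) := by gcongr
      _ = Q / k * ‖f‖ * (Real.exp (-k * (x - a)) * Real.exp (k * (x - a))) := by ring
      _ = Q / k * ‖f‖ := by rw [← Real.exp_add]; simp
  exact isUnit_one_sub_of_norm_conj_lt_one (R := C(Icc a b, ℂ) →L[ℂ] C(Icc a b, ℂ)) hee' he'e hnorm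

end Volterra

/-! ### Algebra of solutions and Lagrange's identity on one interval -/

namespace SolvesOn

variable {q : ℝ → ℝ} {a b : ℝ} {lam : ℂ} {y z : ℝ → ℂ}

theorem intervalIntegrable_coeff (hq : IntervalIntegrable q volume a b) (lam : ℂ) :
    IntervalIntegrable (fun t => (q t : ℂ) - lam) volume a b :=
  (show IntervalIntegrable (fun t => (q t : ℂ)) volume a b from
    ⟨hq.1.ofReal, hq.2.ofReal⟩).sub intervalIntegrable_const

theorem continuousOn (h : SolvesOn q lam a b y z) : ContinuousOn y (Icc a b) :=
  fun x hx => (h.1 x hx).continuousWithinAt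

theorem isPrimitiveOn_deriv (h : SolvesOn q lam a b y z) (hab : a ≤ b)
    (hq : IntervalIntegrable q volume a b) :
    IsPrimitiveOn z (fun t => ((q t : ℂ) - lam) * y t) a b := by
  refine ⟨(intervalIntegrable_coeff hq lam).mul_continuousOn ?_, h.2⟩
  rw [uIcc_of_le hab]; exact h.continuousOn

theorem isPrimitiveOn (h : SolvesOn q lam a b y z) (hab : a ≤ b)
    (hq : IntervalIntegrable q volume a b) : IsPrimitiveOn y z a b :=
  .of_hasDerivWithinAt hab h.1 ((h.isPrimitiveOn_deriv hab hq).continuousOn hab)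

theorem add {y₁ z₁ : ℝ → ℂ} (h : SolvesOn q lam a b y z) (h₁ : SolvesOn q lam a b y₁ z₁)
    (hab : a ≤ b) (hq : IntervalIntegrable q volume a b) :
    SolvesOn q lam a b (fun x => y x + y₁ x) (fun x => z x + z₁ x) := by
  refine ⟨fun x hx => (h.1 x hx).fun_add (h₁.1 x hx), fun x hx => ?_⟩
  simp_rw [mul_add]
  exact ((h.isPrimitiveOn_deriv hab hq).add (h₁.isPrimitiveOn_deriv hab hq) hab).eq_add x hx

theorem const_mul (h : SolvesOn q lam a b y z) (hab : a ≤ b)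
    (hq : IntervalIntegrable q volume a b) (k : ℂ) :
    SolvesOn q lam a b (fun x => k * y x) (fun x => k * z x) := by
  refine ⟨fun x hx => (h.1 x hx).const_mul k, fun x hx => ?_⟩
  simp_rw [mul_left_comm _ k]
  exact ((h.isPrimitiveOn_deriv hab hq).const_mul k).eq_add x hx

theorem conj (h : SolvesOn q lam a b y z) (hab : a ≤ b)
    (hq : IntervalIntegrable q volume a b) :
    SolvesOn q ((starRingEnd ℂ) lam) a b (fun x => (starRingEnd ℂ) (y x))
      (fun x => (starRingEnd ℂ) (z x)) := by
  refine ⟨fun x hx => ?_, fun x hx => ?_⟩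
  · exact (Complex.conjCLE.toContinuousLinearMap.hasFDerivAt (x := y x)).comp_hasDerivWithinAt x
      (h.1 x hx)
  · have := (h.isPrimitiveOn_deriv hab hq).conj.eq_add x hx
    simpa using this

/-- Lagrange's identity. -/
theorem integral_mul {mu : ℂ} {y₁ z₁ : ℝ → ℂ} (h : SolvesOn q lam a b y z)
    (h₁ : SolvesOn q mu a b y₁ z₁) (hab : a ≤ b) (hq : IntervalIntegrable q volume a b)
    {x : ℝ} (hx : x ∈ Icc a b) :
    (y b * z₁ b - z b * y₁ b) - (y x * z₁ x - z x * y₁ x) =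
      (lam - mu) * ∫ t in x..b, y t * y₁ t := by
  have p1 := (h.isPrimitiveOn hab hq).mul (h₁.isPrimitiveOn_deriv hab hq) hab
  have p2 := (h.isPrimitiveOn_deriv hab hq).mul (h₁.isPrimitiveOn hab hq) hab
  have p := (p1.add (p2.const_mul (-1)) hab).sub_eq hab hx (right_mem_Icc.2 hab)
  rw [← intervalIntegral.integral_const_mul]
  calc _ = _ := by ring
    _ = _ := p
    _ = _ := by congr 1; ext t; ring

end SolvesOn

/-! ### The Cauchy problem and analyticity in the spectral parameter -/

theorem differentiable_const_sub_smul {X : Type*} [NormedAddCommGroup X] [NormedSpace ℂ X]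
    (A B : X) : Differentiable ℂ fun lam : ℂ => A - lam • B := by
  fun_prop

section Cauchy

variable {a b : ℝ}

/-- The affine function `x ↦ c + d (x - a)` on `[a, b]`. -/
noncomputable def affineFun (a b : ℝ) (c d : ℂ) : C(Icc a b, ℂ) :=
  c • (1 : C(Icc a b, ℂ)) + d • (⟨fun x => ((x : ℝ) - a : ℝ), by fun_prop⟩ : C(Icc a b, ℂ))

theorem affineFun_apply (c d : ℂ) (x : Icc a b) :
    affineFun a b c d x = c + d * ((x : ℝ) - a : ℝ) := by
  simp [affineFun]

/-- Affine dependence on λ is the source of all analyticity below. -/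
theorem volterra_coeff (hab : a ≤ b) {q : ℝ → ℝ} (hq : IntervalIntegrable q volume a b)
    (lam : ℂ) :
    volterra hab _ (SolvesOn.intervalIntegrable_coeff hq lam) =
      volterra hab _ (SolvesOn.intervalIntegrable_coeff hq 0) -
        lam • volterra hab (fun _ => 1) intervalIntegrable_const := by
  ext f x
  have hs : uIcc a (x : ℝ) ⊆ uIcc a b :=
    uIcc_subset_uIcc left_mem_uIcc (by rw [uIcc_of_le hab]; exact x.2)
  change ∫ t in a..x, ((q t : ℂ) - lam) * IccExtend hab f t =
    (∫ t in a..x, ((q t : ℂ) - 0) * IccExtend hab f t) - lam *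
      ∫ t in a..x, 1 * IccExtend hab f t
  rw [← intervalIntegral.integral_const_mul, ← intervalIntegral.integral_sub]
  · congr 1; ext t; ring
  · exact (intervalIntegrable_mul_IccExtend hab
      (SolvesOn.intervalIntegrable_coeff hq 0) f).mono_set hs
  · exact ((intervalIntegrable_mul_IccExtend hab
      intervalIntegrable_const f).const_mul lam).mono_set hs

theorem differentiable_volterra (hab : a ≤ b) {q : ℝ → ℝ} (hq : IntervalIntegrable q volume a b) :
    Differentiable ℂ fun lam =>
      volterra hab _ (SolvesOn.intervalIntegrable_coeff hq lam) := by
  rw [funext fun lam => volterra_coeff hab hq lam]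
  exact differentiable_const_sub_smul (X := C(Icc a b, ℂ) →L[ℂ] C(Icc a b, ℂ)) _ _

theorem differentiable_doubleVolterra (hab : a ≤ b) {q : ℝ → ℝ}
    (hq : IntervalIntegrable q volume a b) :
    Differentiable ℂ fun lam =>
      doubleVolterra hab _ (SolvesOn.intervalIntegrable_coeff hq lam) := fun lam =>
  (differentiableAt_const _).clm_comp (differentiable_volterra hab hq lam)

/-- A solution of the Cauchy problem is a fixed point of the Volterra equation. -/
theorem SolvesOn.volterra_eq (hab : a ≤ b) {q : ℝ → ℝ} (hq : IntervalIntegrable q volume a b)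
    {lam : ℂ} {y z : ℝ → ℂ} (h : SolvesOn q lam a b y z) :
    (1 - doubleVolterra hab _ (SolvesOn.intervalIntegrable_coeff hq lam))
      ⟨fun x : Icc a b => y x, h.continuousOn.domRestrict⟩ = affineFun a b (y a) (z a) := by
  set f : C(Icc a b, ℂ) := ⟨fun x : Icc a b => y x, h.continuousOn.domRestrict⟩
  set V := volterra hab _ (SolvesOn.intervalIntegrable_coeff hq lam)
  have hf : ∀ t ∈ Icc a b, IccExtend hab f t = y t := fun t ht => by
    rw [IccExtend_of_mem hab _ ht]; rfl
  have hV : ∀ t (ht : t ∈ Icc a b), V f ⟨t, ht⟩ = z t - z a := fun t ht => by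
    rw [volterra_apply, h.2 t ht, add_sub_cancel_left]
    refine intervalIntegral.integral_congr fun s hs => ?_
    rw [uIcc_of_le ht.1] at hs
    rw [hf s ⟨hs.1, hs.2.trans ht.2⟩]
  ext x
  change y x - volterra hab (fun _ => 1) intervalIntegrable_const (V f) x = _
  rw [volterra_apply, affineFun_apply]
  have h1 : ∫ t in a..x, 1 * IccExtend hab (V f) t = ∫ t in a..x, (z t - z a) := by
    refine intervalIntegral.integral_congr fun s hs => ?_
    rw [uIcc_of_le x.2.1] at hs
    have hm : s ∈ Icc a b := ⟨hs.1, hs.2.trans x.2.2⟩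
    rw [one_mul, IccExtend_of_mem hab _ hm, hV]
  have hs : uIcc a (x : ℝ) ⊆ uIcc a b :=
    uIcc_subset_uIcc left_mem_uIcc (by rw [uIcc_of_le hab]; exact x.2)
  have hp := h.isPrimitiveOn hab hq
  rw [h1, intervalIntegral.integral_sub (hp.intervalIntegrable.mono_set hs)
    intervalIntegrable_const, hp.eq_add x x.2, intervalIntegral.integral_const]
  simp [mul_comm]
  ring

/-- Uniqueness in the Cauchy problem. -/
theorem SolvesOn.unique (hab : a ≤ b) {q : ℝ → ℝ} (hq : IntervalIntegrable q volume a b)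
    {lam : ℂ} {y z y₁ z₁ : ℝ → ℂ} (h : SolvesOn q lam a b y z) (h₁ : SolvesOn q lam a b y₁ z₁)
    (hy : y a = y₁ a) (hz : z a = z₁ a) : ∀ x ∈ Icc a b, y x = y₁ x ∧ z x = z₁ x := by
  have hu := isUnit_one_sub_doubleVolterra hab (SolvesOn.intervalIntegrable_coeff hq lam)
  have hinj : Function.Injective fun f : C(Icc a b, ℂ) =>
      (1 - doubleVolterra hab _ (SolvesOn.intervalIntegrable_coeff hq lam)) f := by
    obtain ⟨u, hu⟩ := hu
    rw [← hu]
    refine Function.LeftInverse.injective (g := (u⁻¹).1) fun f => ?_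
    exact congrArg (fun A : C(Icc a b, ℂ) →L[ℂ] C(Icc a b, ℂ) => A f) u.inv_mul
  have heq := hinj ((h.volterra_eq hab hq).trans
    ((by rw [hy, hz] : affineFun a b (y a) (z a) = _).trans (h₁.volterra_eq hab hq).symm))
  have hyy : ∀ x ∈ Icc a b, y x = y₁ x := fun x hx => congrArg (fun f => f ⟨x, hx⟩) heq
  refine fun x hx => ⟨hyy x hx, ?_⟩
  rw [h.2 x hx, h₁.2 x hx, hz]
  congr 1
  refine intervalIntegral.integral_congr fun s hs => ?_
  rw [uIcc_of_le hx.1] at hs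
  rw [hyy s ⟨hs.1, hs.2.trans hx.2⟩]

/-- Existence in the Cauchy problem, with analytic dependence on the spectral parameter. -/
theorem exists_solution_family (hab : a ≤ b) {q : ℝ → ℝ} (hq : IntervalIntegrable q volume a b)
    {c d : ℂ → ℂ} (hc : Differentiable ℂ c) (hd : Differentiable ℂ d) :
    ∃ y z : ℂ → ℝ → ℂ, (∀ lam, SolvesOn q lam a b (y lam) (z lam)) ∧
      (∀ lam, y lam a = c lam) ∧ (∀ lam, z lam a = d lam) ∧
      Differentiable ℂ (fun lam => y lam b) ∧ Differentiable ℂ (fun lam => z lam b) ∧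
      ∀ f : ℝ → ℂ, ContinuousOn f (Icc a b) →
        Continuous fun lam => ∫ x in a..b, y lam x * f x := by
  let T : ℂ → C(Icc a b, ℂ) →L[ℂ] C(Icc a b, ℂ) := fun lam =>
    doubleVolterra hab _ (SolvesOn.intervalIntegrable_coeff hq lam)
  let V : ℂ → C(Icc a b, ℂ) →L[ℂ] C(Icc a b, ℂ) := fun lam =>
    volterra hab _ (SolvesOn.intervalIntegrable_coeff hq lam)
  have hu : ∀ lam, IsUnit (1 - T lam) := fun lam =>
    isUnit_one_sub_doubleVolterra hab (SolvesOn.intervalIntegrable_coeff hq lam)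
  have hT : Differentiable ℂ fun lam => 1 - T lam :=
    Differentiable.const_sub (𝕜 := ℂ) (E := ℂ) (f := T) (F := C(Icc a b, ℂ) →L[ℂ] C(Icc a b, ℂ))
      (differentiable_doubleVolterra hab hq) 1
  have hinv : Differentiable ℂ fun lam => Ring.inverse (1 - T lam) := fun lam =>
    DifferentiableAt.inverse (𝕜 := ℂ) (z := lam) (h := fun lam => 1 - T lam)
      (R := C(Icc a b, ℂ) →L[ℂ] C(Icc a b, ℂ)) (hT lam) (hu lam)
  -- The solution is (1 - T)⁻¹ applied to the affine function with the given initial data; it is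
  -- analytic because inversion is analytic on units.
  let F : ℂ → C(Icc a b, ℂ) := fun lam => Ring.inverse (1 - T lam) (affineFun a b (c lam) (d lam))
  have hF : Differentiable ℂ F := by
    refine hinv.clm_apply ?_
    unfold affineFun
    fun_prop
  have heval : ∀ x, Differentiable ℂ fun lam => F lam x := fun x =>
    (ContinuousMap.evalCLM ℂ x : C(Icc a b, ℂ) →L[ℂ] ℂ).differentiable.comp hF
  have hVeval : ∀ x, Differentiable ℂ fun lam => V lam (F lam) x := fun x =>
    (ContinuousMap.evalCLM ℂ x : C(Icc a b, ℂ) →L[ℂ] ℂ).differentiable.comp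
      ((differentiable_volterra hab hq).clm_apply hF)
  have hfix : ∀ lam (x : Icc a b), F lam x = c lam + d lam * ((x : ℝ) - a : ℝ) +
      ∫ t in a..x, IccExtend hab (V lam (F lam)) t := fun lam x => by
    have h1 : (1 - T lam) (F lam) = affineFun a b (c lam) (d lam) :=
      congrArg (fun A : C(Icc a b, ℂ) →L[ℂ] C(Icc a b, ℂ) => A (affineFun a b (c lam) (d lam)))
        (Ring.mul_inverse_cancel _ (hu lam))
    have h2 : F lam x - ∫ t in a..x, 1 * IccExtend hab (V lam (F lam)) t =
        c lam + d lam * ((x : ℝ) - a : ℝ) := by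
      rw [← affineFun_apply, ← h1]; rfl
    simp only [one_mul] at h2
    rw [← h2]; ring
  have hz : ∀ lam x (hx : x ∈ Icc a b), ∫ t in a..x, ((q t : ℂ) - lam) * IccExtend hab (F lam) t =
      V lam (F lam) ⟨x, hx⟩ := fun lam x hx => rfl
  refine ⟨fun lam => IccExtend hab (F lam),
    fun lam x => d lam + ∫ t in a..x, ((q t : ℂ) - lam) * IccExtend hab (F lam) t,
    fun lam => ⟨fun x hx => ?_, fun x hx => ?_⟩, fun lam => ?_, fun lam => ?_, ?_, ?_,
    fun f hf => ?_⟩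
  · have hcont : Continuous (IccExtend hab (V lam (F lam))) :=
      (V lam (F lam)).continuous.Icc_extend'
    have h1 : HasDerivAt (fun x : ℝ => c lam + d lam * ((x - a : ℝ) : ℂ) +
        ∫ t in a..x, IccExtend hab (V lam (F lam)) t)
        (d lam * ((1 : ℝ) : ℂ) + IccExtend hab (V lam (F lam)) x) x :=
      ((((hasDerivAt_id x).sub_const a).ofReal_comp.const_mul _).const_add _).add
        (hcont.integral_hasStrictDerivAt a x).hasDerivAt
    rw [IccExtend_of_mem hab _ hx, ← hz, Complex.ofReal_one, mul_one] at h1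
    refine h1.hasDerivWithinAt.congr (fun t ht => ?_) ?_
    · exact (IccExtend_of_mem hab _ ht).trans (hfix _ _)
    · exact (IccExtend_of_mem hab _ hx).trans (hfix _ _)
  · simp
  · refine (IccExtend_left hab _).trans ((hfix _ _).trans ?_)
    simp
  · simp
  · simp only [IccExtend_right]
    exact heval _
  · simp only [hz _ b (right_mem_Icc.2 hab)]
    exact hd.add (hVeval _)
  · have hfi : IntervalIntegrable f volume a b :=
      ContinuousOn.intervalIntegrable (by rwa [uIcc_of_le hab])
    -- Integration against f is a Volterra operator evaluated at b, so continuity in λ is that of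
    -- bounded operators.
    have h3 : (fun lam => ∫ x in a..b, IccExtend hab (F lam) x * f x) =
        fun lam => volterra hab f hfi (F lam) ⟨b, right_mem_Icc.2 hab⟩ := by
      ext lam
      simp only [volterra_apply, mul_comm]
    rw [h3]
    exact (ContinuousMap.evalCLM ℂ _ : C(Icc a b, ℂ) →L[ℂ] ℂ).continuous.comp
      ((volterra hab f hfi).continuous.comp hF.continuous)

end Cauchy

/-! ### Solutions across the origin and boundary forms -/

open scoped ComplexConjugate

namespace BrokenFun

/-- The linear combination `k y + l y₁`. -/
noncomputable def comb (k : ℂ) (y : BrokenFun) (l : ℂ) (y₁ : BrokenFun) : BrokenFun where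
  left x := k * y.left x + l * y₁.left x
  dleft x := k * y.dleft x + l * y₁.dleft x
  right x := k * y.right x + l * y₁.right x
  dright x := k * y.dright x + l * y₁.dright x

/-- The complex conjugate of `y`. -/
noncomputable def conjFun (y : BrokenFun) : BrokenFun where
  left x := (starRingEnd ℂ) (y.left x)
  dleft x := (starRingEnd ℂ) (y.dleft x)
  right x := (starRingEnd ℂ) (y.right x)
  dright x := (starRingEnd ℂ) (y.dright x)

end BrokenFun

namespace TransferProblem

variable (P : TransferProblem)

/-- The bilinear pairing `∫_{-S}^{S} y y₁`. -/
noncomputable def pairing (y y₁ : BrokenFun) : ℂ :=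
  (∫ x in (-P.S)..0, y.left x * y₁.left x) + ∫ x in (0 : ℝ)..P.S, y.right x * y₁.right x

/-- The square of the `L²` norm of `y`. -/
noncomputable def normSq (y : BrokenFun) : ℝ :=
  (∫ x in (-P.S)..0, ‖y.left x‖ ^ 2) + ∫ x in (0 : ℝ)..P.S, ‖y.right x‖ ^ 2

/-- The terminal boundary form. -/
noncomputable def endForm (y : BrokenFun) : ℂ :=
  y.right P.S * (Real.cos P.β : ℂ) - y.dright P.S * (Real.sin P.β : ℂ)

theorem neg_S_le : -P.S ≤ 0 := neg_nonpos.2 P.S_pos.le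

theorem intervalIntegrable_q : IntervalIntegrable P.q volume (-P.S) P.S := by
  have h : -P.S ≤ P.S := by linarith [P.S_pos]
  rw [intervalIntegrable_iff_integrableOn_Icc_of_le h]
  exact P.q_memLp.integrable (by norm_num)

theorem intervalIntegrable_q_left : IntervalIntegrable P.q volume (-P.S) 0 :=
  P.intervalIntegrable_q.mono_set (by
    rw [uIcc_of_le P.neg_S_le, uIcc_of_le (by linarith [P.S_pos])]
    exact Icc_subset_Icc_right P.S_pos.le)

theorem intervalIntegrable_q_right : IntervalIntegrable P.q volume 0 P.S :=
  P.intervalIntegrable_q.mono_set (by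
    rw [uIcc_of_le P.S_pos.le, uIcc_of_le (by linarith [P.S_pos])]
    exact Icc_subset_Icc_left P.neg_S_le)

theorem det_M_complex :
    (P.M 0 0 : ℂ) * P.M 1 1 - (P.M 0 1 : ℂ) * P.M 1 0 = 1 := by
  have := P.det_M
  rw [Matrix.det_fin_two] at this
  exact_mod_cast this

theorem normSq_nonneg (y : BrokenFun) : 0 ≤ P.normSq y :=
  add_nonneg (intervalIntegral.integral_nonneg P.neg_S_le fun _ _ => by positivity)
    (intervalIntegral.integral_nonneg P.S_pos.le fun _ _ => by positivity)

variable {P} {lam mu : ℂ} {y y₁ : BrokenFun}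

theorem endForm_comb (k l : ℂ) :
    P.endForm (.comb k y l y₁) = k * P.endForm y + l * P.endForm y₁ := by
  simp only [endForm, BrokenFun.comb]; ring

namespace IsSolution

theorem comb (h : P.IsSolution lam y) (h₁ : P.IsSolution lam y₁) (k l : ℂ) :
    P.IsSolution lam (.comb k y l y₁) := by
  obtain ⟨a1, a2, a3, a4⟩ := h
  obtain ⟨b1, b2, b3, b4⟩ := h₁
  have L := P.neg_S_le
  have R := P.S_pos.le
  have qL := P.intervalIntegrable_q_left
  have qR := P.intervalIntegrable_q_right
  refine ⟨(a1.const_mul L qL k).add (b1.const_mul L qL l) L qL,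
    (a2.const_mul R qR k).add (b2.const_mul R qR l) R qR, ?_, ?_⟩
  · simp only [BrokenFun.comb, a3, b3]; ring
  · simp only [BrokenFun.comb, a4, b4]; ring

theorem conjFun (h : P.IsSolution lam y) : P.IsSolution (conj lam) y.conjFun := by
  obtain ⟨a1, a2, a3, a4⟩ := h
  refine ⟨a1.conj P.neg_S_le P.intervalIntegrable_q_left,
    a2.conj P.S_pos.le P.intervalIntegrable_q_right, ?_, ?_⟩
  · simp [BrokenFun.conjFun, a3]
  · simp [BrokenFun.conjFun, a4]

/-- Uniqueness of the solution with given initial data at `-S`. -/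
theorem unique (h : P.IsSolution lam y) (h₁ : P.IsSolution lam y₁)
    (hy : y.left (-P.S) = y₁.left (-P.S)) (hz : y.dleft (-P.S) = y₁.dleft (-P.S)) :
    (∀ x ∈ Icc (-P.S) 0, y.left x = y₁.left x ∧ y.dleft x = y₁.dleft x) ∧
      ∀ x ∈ Icc 0 P.S, y.right x = y₁.right x ∧ y.dright x = y₁.dright x := by
  have H := h.1.unique P.neg_S_le P.intervalIntegrable_q_left h₁.1 hy hz
  obtain ⟨e1, e2⟩ := H 0 ⟨P.neg_S_le, le_rfl⟩
  refine ⟨H, h.2.1.unique P.S_pos.le P.intervalIntegrable_q_right h₁.2.1 ?_ ?_⟩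
  · rw [h.2.2.1, h₁.2.2.1, e1, e2]
  · rw [h.2.2.2, h₁.2.2.2, e1, e2]

/-- Lagrange's identity from a point of `[-S, 0]` to the right endpoint. -/
theorem lagrange (h : P.IsSolution lam y) (h₁ : P.IsSolution mu y₁) {x : ℝ}
    (hx : x ∈ Icc (-P.S) 0) :
    (y.right P.S * y₁.dright P.S - y.dright P.S * y₁.right P.S) -
      (y.left x * y₁.dleft x - y.dleft x * y₁.left x) =
    (lam - mu) * ((∫ t in x..0, y.left t * y₁.left t) +
      ∫ t in (0 : ℝ)..P.S, y.right t * y₁.right t) := by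
  have e1 := h.1.integral_mul h₁.1 P.neg_S_le P.intervalIntegrable_q_left hx
  have e2 := h.2.1.integral_mul h₁.2.1 P.S_pos.le P.intervalIntegrable_q_right
    (left_mem_Icc.2 P.S_pos.le)
  rw [h.2.2.1, h.2.2.2, h₁.2.2.1, h₁.2.2.2] at e2
  -- The transfer condition multiplies the Wronskian at the origin by det M, so the two interior
  -- boundary terms cancel.
  have hd := P.det_M_complex
  linear_combination e1 + e2 + (y.left 0 * y₁.dleft 0 - y.dleft 0 * y₁.left 0) * hd

theorem lagrange_pairing (h : P.IsSolution lam y) (h₁ : P.IsSolution mu y₁) :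
    (y.right P.S * y₁.dright P.S - y.dright P.S * y₁.right P.S) -
      (y.left (-P.S) * y₁.dleft (-P.S) - y.dleft (-P.S) * y₁.left (-P.S)) =
    (lam - mu) * P.pairing y y₁ :=
  h.lagrange h₁ (left_mem_Icc.2 P.neg_S_le)

/-- Lagrange's identity for y and its conjugate, which solves the problem at λ̄ because q and M are
real; λ - λ̄ = 2i Im λ. -/
theorem lagrange_im (h : P.IsSolution lam y) {x : ℝ} (hx : x ∈ Icc (-P.S) 0) :
    (y.dleft x * conj (y.left x)).im - (y.dright P.S * conj (y.right P.S)).im =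
      lam.im * ((∫ t in x..0, ‖y.left t‖ ^ 2) + ∫ t in (0 : ℝ)..P.S, ‖y.right t‖ ^ 2) := by
  have e := h.lagrange h.conjFun hx
  simp only [BrokenFun.conjFun, Complex.mul_conj'] at e
  have i1 : ∫ t in x..0, ((‖y.left t‖ : ℂ) ^ 2) = ((∫ t in x..0, ‖y.left t‖ ^ 2 : ℝ) : ℂ) := by
    rw [← intervalIntegral.integral_ofReal]; simp
  have i2 : ∫ t in (0 : ℝ)..P.S, ((‖y.right t‖ : ℂ) ^ 2) =
      ((∫ t in (0 : ℝ)..P.S, ‖y.right t‖ ^ 2 : ℝ) : ℂ) := by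
    rw [← intervalIntegral.integral_ofReal]; simp
  rw [i1, i2, ← Complex.ofReal_add] at e
  have e' := congrArg Complex.im e
  simp only [Complex.sub_im, Complex.mul_im, Complex.conj_re, Complex.conj_im, Complex.ofReal_re,
    Complex.ofReal_im, Complex.sub_re] at e' ⊢
  linarith

theorem lagrange_normSq (h : P.IsSolution lam y) :
    (y.dleft (-P.S) * conj (y.left (-P.S))).im - (y.dright P.S * conj (y.right P.S)).im =
      lam.im * P.normSq y :=
  h.lagrange_im (left_mem_Icc.2 P.neg_S_le)

theorem continuousOn_left (h : P.IsSolution lam y) : ContinuousOn y.left (Icc (-P.S) 0) :=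
  h.1.continuousOn

theorem continuousOn_right (h : P.IsSolution lam y) : ContinuousOn y.right (Icc 0 P.S) :=
  h.2.1.continuousOn

/-- A solution with vanishing norm has vanishing initial data. -/
theorem initial_eq_zero (h : P.IsSolution lam y) (h0 : P.normSq y = 0) :
    y.left (-P.S) = 0 ∧ y.dleft (-P.S) = 0 := by
  have hL : 0 ≤ ∫ x in (-P.S)..0, ‖y.left x‖ ^ 2 :=
    intervalIntegral.integral_nonneg P.neg_S_le fun _ _ => by positivity
  have hR : 0 ≤ ∫ x in (0 : ℝ)..P.S, ‖y.right x‖ ^ 2 :=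
    intervalIntegral.integral_nonneg P.S_pos.le fun _ _ => by positivity
  have hz : ∫ x in (-P.S)..0, ‖y.left x‖ ^ 2 = 0 := by
    unfold normSq at h0; linarith
  have hlt : -P.S < 0 := neg_lt_zero.2 P.S_pos
  have hall : ∀ x ∈ Icc (-P.S) 0, y.left x = 0 := by
    by_contra! hne
    obtain ⟨x, hx, hxn⟩ := hne
    refine (intervalIntegral.integral_pos (f := fun x => ‖y.left x‖ ^ 2) hlt
      (h.continuousOn_left.norm.pow 2)
      (fun _ _ => by positivity) ⟨x, hx, by positivity⟩).ne' hz
  have hm : -P.S ∈ Icc (-P.S) 0 := left_mem_Icc.2 P.neg_S_le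
  -- The initial slope is the one-sided derivative at -S of a function vanishing on [-S, 0].
  refine ⟨hall _ hm, ?_⟩
  have h1 := h.1.1 _ hm
  have h2 : HasDerivWithinAt y.left 0 (Icc (-P.S) 0) (-P.S) :=
    (hasDerivWithinAt_const _ _ 0).congr hall (hall _ hm)
  exact (uniqueDiffOn_Icc hlt _ hm).eq_deriv _ h1 h2

end IsSolution

section EndForm

theorem sin_sq_add_cos_sq_complex (t : ℝ) :
    (Real.sin t : ℂ) * Real.sin t + (Real.cos t : ℂ) * Real.cos t = 1 := by
  have := Real.sin_sq_add_cos_sq t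
  exact_mod_cast (by nlinarith : Real.sin t * Real.sin t + Real.cos t * Real.cos t = 1)

/-- The coefficient of terminal data satisfying the boundary condition at `S`. -/
noncomputable def endCoeff (P : TransferProblem) (y : BrokenFun) : ℂ :=
  y.right P.S * (Real.sin P.β : ℂ) + y.dright P.S * (Real.cos P.β : ℂ)

theorem right_eq_of_endForm (h : P.endForm y = 0) :
    y.right P.S = P.endCoeff y * Real.sin P.β := by
  unfold endForm at h; unfold endCoeff
  linear_combination (Real.cos P.β : ℂ) * h - y.right P.S * sin_sq_add_cos_sq_complex P.β

theorem dright_eq_of_endForm (h : P.endForm y = 0) :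
    y.dright P.S = P.endCoeff y * Real.cos P.β := by
  unfold endForm at h; unfold endCoeff
  linear_combination -(Real.sin P.β : ℂ) * h - y.dright P.S * sin_sq_add_cos_sq_complex P.β

/-- The terminal data are a complex multiple of the real vector (sin β, cos β). -/
theorem im_end_eq_zero (h : P.endForm y = 0) :
    (y.dright P.S * conj (y.right P.S)).im = 0 := by
  rw [right_eq_of_endForm h, dright_eq_of_endForm h]
  simp
  ring

theorem wronskian_end_eq_zero (h : P.endForm y = 0) (h₁ : P.endForm y₁ = 0) :
    y.right P.S * y₁.dright P.S - y.dright P.S * y₁.right P.S = 0 := by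
  rw [right_eq_of_endForm h, dright_eq_of_endForm h, right_eq_of_endForm h₁,
    dright_eq_of_endForm h₁]
  ring

end EndForm

/-! ### Characteristic functions, eigenvalues and norming constants -/

/-- Solutions with fixed initial data, as analytic functions of the spectral parameter. -/
theorem exists_isSolution_family (P : TransferProblem) (c d : ℂ) :
    ∃ y : ℂ → BrokenFun, (∀ lam, P.IsSolution lam (y lam)) ∧
      (∀ lam, (y lam).left (-P.S) = c) ∧ (∀ lam, (y lam).dleft (-P.S) = d) ∧
      Differentiable ℂ (fun lam => P.endForm (y lam)) ∧
      ∀ v : BrokenFun, ContinuousOn v.left (Icc (-P.S) 0) → ContinuousOn v.right (Icc 0 P.S) →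
        Continuous fun lam => P.pairing (y lam) v := by
  obtain ⟨y, z, hs, hy, hz, dy, dz, hcont⟩ := exists_solution_family P.neg_S_le
    P.intervalIntegrable_q_left (differentiable_const c) (differentiable_const d)
  obtain ⟨y', z', hs', hy', hz', dy', dz', hcont'⟩ := exists_solution_family P.S_pos.le
    P.intervalIntegrable_q_right (c := fun lam => (P.M 0 0 : ℂ) * y lam 0 + (P.M 0 1 : ℂ) * z lam 0)
    (d := fun lam => (P.M 1 0 : ℂ) * y lam 0 + (P.M 1 1 : ℂ) * z lam 0)
    (by fun_prop) (by fun_prop)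
  refine ⟨fun lam => ⟨y lam, z lam, y' lam, z' lam⟩,
    fun lam => ⟨hs lam, hs' lam, hy' lam, hz' lam⟩, hy, hz, ?_, fun v hl hr => ?_⟩
  · unfold endForm
    fun_prop
  · exact (hcont _ hl).add (hcont' _ hr)

end TransferProblem

namespace TransferProblem

variable (P : TransferProblem)

/-- The solution `u_α(·, lam)`. -/
noncomputable def solU : ℂ → BrokenFun :=
  (P.exists_isSolution_family (Real.cos P.α) (-Real.sin P.α)).choose

/-- The solution `w_α(·, lam)`. -/
noncomputable def solW : ℂ → BrokenFun :=
  (P.exists_isSolution_family (Real.sin P.α) (Real.cos P.α)).choose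

/-- The terminal boundary form of `u_α(·, lam)`. -/
noncomputable def charU (lam : ℂ) : ℂ := P.endForm (P.solU lam)

/-- The terminal boundary form of `w_α(·, lam)`. -/
noncomputable def charW (lam : ℂ) : ℂ := P.endForm (P.solW lam)

theorem isU_solU (lam : ℂ) : P.IsU lam (P.solU lam) :=
  have h := (P.exists_isSolution_family (Real.cos P.α) (-Real.sin P.α)).choose_spec
  ⟨h.1 lam, h.2.1 lam, h.2.2.1 lam⟩

theorem isW_solW (lam : ℂ) : P.IsW lam (P.solW lam) :=
  have h := (P.exists_isSolution_family (Real.sin P.α) (Real.cos P.α)).choose_spec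
  ⟨h.1 lam, h.2.1 lam, h.2.2.1 lam⟩

theorem differentiable_charU : Differentiable ℂ P.charU :=
  (P.exists_isSolution_family (Real.cos P.α) (-Real.sin P.α)).choose_spec.2.2.2.1

theorem differentiable_charW : Differentiable ℂ P.charW :=
  (P.exists_isSolution_family (Real.sin P.α) (Real.cos P.α)).choose_spec.2.2.2.1

theorem continuous_pairing_solW {v : BrokenFun} {mu : ℂ} (hv : P.IsSolution mu v) :
    Continuous fun lam => P.pairing (P.solW lam) v :=
  (P.exists_isSolution_family (Real.sin P.α) (Real.cos P.α)).choose_spec.2.2.2.2 v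
    hv.continuousOn_left hv.continuousOn_right

variable {P} {lam mu : ℂ} {y y₁ : BrokenFun}

theorem IsSolution.endForm_eq (h : P.IsSolution lam y) (h₁ : P.IsSolution lam y₁)
    (hy : y.left (-P.S) = y₁.left (-P.S)) (hz : y.dleft (-P.S) = y₁.dleft (-P.S)) :
    P.endForm y = P.endForm y₁ := by
  obtain ⟨e1, e2⟩ := (h.unique h₁ hy hz).2 P.S (right_mem_Icc.2 P.S_pos.le)
  simp only [endForm, e1, e2]

theorem IsSolution.pairing_self_eq (h : P.IsSolution lam y) (h₁ : P.IsSolution lam y₁)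
    (hy : y.left (-P.S) = y₁.left (-P.S)) (hz : y.dleft (-P.S) = y₁.dleft (-P.S)) :
    P.pairing y y = P.pairing y y₁ := by
  obtain ⟨e1, e2⟩ := h.unique h₁ hy hz
  unfold pairing
  congr 1 <;> refine intervalIntegral.integral_congr fun x hx => ?_
  · rw [uIcc_of_le P.neg_S_le] at hx
    simp only [(e1 x hx).1]
  · rw [uIcc_of_le P.S_pos.le] at hx
    simp only [(e2 x hx).1]

theorem isWeylValue_iff {z : ℂ} :
    P.IsWeylValue lam z ↔ P.charU lam + z * P.charW lam = 0 := by
  constructor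
  · rintro ⟨u, w, hu, hw, h⟩
    have hU := P.isU_solU lam
    have hW := P.isW_solW lam
    rw [charU, charW, ← hu.1.endForm_eq hU.1 (hu.2.1.trans hU.2.1.symm) (hu.2.2.trans hU.2.2.symm),
      ← hw.1.endForm_eq hW.1 (hw.2.1.trans hW.2.1.symm) (hw.2.2.trans hW.2.2.symm), ← h]
    unfold endForm; ring
  · intro h
    refine ⟨_, _, P.isU_solU lam, P.isW_solW lam, ?_⟩
    rw [← h]
    unfold charU charW endForm; ring

/-- The boundary condition at -S forces the initial data to be a multiple of (sin α, cos α), so an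
eigenfunction is a nonzero multiple of w_α. -/
theorem isEigenvalue_iff : P.IsEigenvalue lam ↔ P.charW lam = 0 := by
  have hW := P.isW_solW lam
  have hsc := sin_sq_add_cos_sq_complex P.α
  constructor
  · rintro ⟨y, hy, hne, h0, h1⟩
    -- The component of the initial data along (sin α, cos α); the orthogonal component is zero by
    -- `h0`.
    set k : ℂ := y.left (-P.S) * Real.sin P.α + y.dleft (-P.S) * Real.cos P.α
    have hk1 : y.left (-P.S) = (BrokenFun.comb k (P.solW lam) 0 (P.solW lam)).left (-P.S) := by
      simp only [BrokenFun.comb, hW.2.1]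
      linear_combination (Real.cos P.α : ℂ) * h0 - y.left (-P.S) * hsc
    have hk2 : y.dleft (-P.S) = (BrokenFun.comb k (P.solW lam) 0 (P.solW lam)).dleft (-P.S) := by
      simp only [BrokenFun.comb, hW.2.2]
      linear_combination -(Real.sin P.α : ℂ) * h0 - y.dleft (-P.S) * hsc
    have hsol := hW.1.comb hW.1 k 0
    have hk : k ≠ 0 := by
      intro hk
      obtain ⟨e1, e2⟩ := hy.unique hsol hk1 hk2
      rcases hne with ⟨x, hx, hn⟩ | ⟨x, hx, hn⟩
      · exact hn ((e1 x hx).1.trans (by simp [BrokenFun.comb, hk]))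
      · exact hn ((e2 x hx).1.trans (by simp [BrokenFun.comb, hk]))
    have h2 := hy.endForm_eq hsol hk1 hk2
    rw [endForm_comb, zero_mul, add_zero, show P.endForm y = 0 from h1] at h2
    exact (mul_eq_zero.1 h2.symm).resolve_left hk
  · intro h
    refine ⟨_, hW.1, ?_, ?_, h⟩
    · by_contra! hne
      obtain ⟨e1, e2⟩ := hW.1.initial_eq_zero (by
        unfold normSq
        rw [intervalIntegral.integral_congr (a := -P.S) (g := fun _ => (0 : ℝ)),
          intervalIntegral.integral_congr (b := P.S) (g := fun _ => (0 : ℝ))]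
        · simp
        · intro x hx
          rw [uIcc_of_le P.S_pos.le] at hx
          simp [hne.2 x hx]
        · intro x hx
          rw [uIcc_of_le P.neg_S_le] at hx
          simp [hne.1 x hx])
      rw [hW.2.1] at e1
      rw [hW.2.2] at e2
      rw [e1, e2] at hsc
      simp at hsc
    · rw [hW.2.1, hW.2.2]; ring

theorem isNormingConstant_iff {a : ℂ} :
    P.IsNormingConstant lam a ↔ a = P.pairing (P.solW lam) (P.solW lam) := by
  have hW := P.isW_solW lam
  constructor
  · rintro ⟨w, hw, rfl⟩
    have e1 : w.left (-P.S) = (P.solW lam).left (-P.S) := hw.2.1.trans hW.2.1.symm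
    have e2 : w.dleft (-P.S) = (P.solW lam).dleft (-P.S) := hw.2.2.trans hW.2.2.symm
    have h1 := hw.1.pairing_self_eq hW.1 e1 e2
    have h2 := hW.1.pairing_self_eq hw.1 e1.symm e2.symm
    rw [h2]
    refine Eq.trans ?_ (h1.trans ?_)
    · simp only [pairing, sq]
    · simp only [pairing, mul_comm]
  · rintro rfl
    exact ⟨_, hW, by simp only [pairing, sq]⟩

/-- Self-adjointness: if `charW` vanished, both boundary terms of Lagrange's identity would too,
leaving Im λ · ‖w_α‖² = 0. -/
theorem charW_ne_zero_of_im_ne_zero (h : lam.im ≠ 0) : P.charW lam ≠ 0 := by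
  intro h0
  have hW := P.isW_solW lam
  have e := hW.1.lagrange_normSq
  rw [im_end_eq_zero h0, hW.2.1, hW.2.2] at e
  have e0 : P.normSq (P.solW lam) = 0 := by
    simpa [h, ← Complex.ofReal_cos, ← Complex.ofReal_sin] using e
  obtain ⟨e1, e2⟩ := hW.1.initial_eq_zero e0
  rw [hW.2.1] at e1
  rw [hW.2.2] at e2
  have hsc := sin_sq_add_cos_sq_complex P.α
  rw [e1, e2] at hsc
  simp at hsc

/-- The Wronskian of u_α and w_α is 1 at -S and is conserved; at S it equals this product when w_α
meets the terminal condition. -/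
theorem endCoeff_mul_charU (h : P.charW mu = 0) : endCoeff P (P.solW mu) * P.charU mu = 1 := by
  have hU := P.isU_solU mu
  have hW := P.isW_solW mu
  have e := hU.1.lagrange_pairing hW.1
  rw [right_eq_of_endForm h, dright_eq_of_endForm h, hU.2.1, hU.2.2, hW.2.1, hW.2.2] at e
  unfold charU endForm
  linear_combination e + sin_sq_add_cos_sq_complex P.α

/-- Apply Lagrange's identity to w_α at λ and at μ. The terms at -S cancel since the initial data do
not depend on λ, and the Wronskian at S is `endCoeff` times `charW lam`; `endCoeff` is the inverse
of `charU mu`. -/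
theorem charW_eq (h : P.charW mu = 0) (lam : ℂ) :
    P.charW lam = (lam - mu) * (P.charU mu * P.pairing (P.solW lam) (P.solW mu)) := by
  have hL := P.isW_solW lam
  have hW := P.isW_solW mu
  have e := hL.1.lagrange_pairing hW.1
  have e1 := endCoeff_mul_charU h
  rw [right_eq_of_endForm h, dright_eq_of_endForm h, hL.2.1, hL.2.2, hW.2.1, hW.2.2] at e
  rw [show P.charW lam = P.endForm (P.solW lam) from rfl]
  have e2 : endCoeff P (P.solW mu) * P.endForm (P.solW lam) =
      (lam - mu) * P.pairing (P.solW lam) (P.solW mu) := by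
    unfold endForm
    linear_combination e
  linear_combination P.charU mu * e2 - P.endForm (P.solW lam) * e1

/-- By `charW_eq` the difference quotient is an explicit pairing, so continuity of that pairing at μ
is enough. This identity ties norming constants to residues. -/
theorem hasDerivAt_charW (h : P.charW mu = 0) :
    HasDerivAt P.charW (P.pairing (P.solW mu) (P.solW mu) * P.charU mu) mu := by
  rw [hasDerivAt_iff_tendsto_slope]
  have hc : Continuous fun lam => P.charU mu * P.pairing (P.solW lam) (P.solW mu) :=
    continuous_const.mul (P.continuous_pairing_solW (P.isW_solW mu).1)
  have ht := (hc.tendsto mu).mono_left (nhdsWithin_le_nhds (s := {mu}ᶜ))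
  rw [mul_comm] at ht
  refine ht.congr' ?_
  filter_upwards [self_mem_nhdsWithin] with lam hlam
  have : lam - mu ≠ 0 := sub_ne_zero.2 hlam
  rw [slope_def_field, h, charW_eq h lam]
  field_simp
  ring

theorem charU_ne_zero (h : P.charW mu = 0) : P.charU mu ≠ 0 :=
  right_ne_zero_of_mul (endCoeff_mul_charU h ▸ one_ne_zero)

theorem pairing_conjFun (y : BrokenFun) : P.pairing y y.conjFun = P.normSq y := by
  unfold pairing normSq
  simp only [BrokenFun.conjFun, Complex.mul_conj']
  rw [Complex.ofReal_add, ← intervalIntegral.integral_ofReal, ← intervalIntegral.integral_ofReal]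
  simp

/-- At an eigenvalue μ is real, so w_α is real by uniqueness and its bilinear square is its L² norm
squared, which is positive. -/
theorem pairing_solW_ne_zero (h : P.charW mu = 0) :
    P.pairing (P.solW mu) (P.solW mu) ≠ 0 := by
  have hW := P.isW_solW mu
  have him : mu.im = 0 := by_contra fun hne => charW_ne_zero_of_im_ne_zero hne h
  have hsol := hW.1.conjFun
  rw [Complex.conj_eq_iff_im.2 him] at hsol
  rw [hW.1.pairing_self_eq hsol, pairing_conjFun]
  · intro h0
    obtain ⟨e1, e2⟩ := hW.1.initial_eq_zero (by exact_mod_cast h0)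
    have hsc := sin_sq_add_cos_sq_complex P.α
    rw [← hW.2.1, ← hW.2.2, e1, e2] at hsc
    simp at hsc
  · simp only [BrokenFun.conjFun, hW.2.1, Complex.conj_ofReal]
  · simp only [BrokenFun.conjFun, hW.2.2, Complex.conj_ofReal]

/-- Weighted arithmetic–geometric mean inequality; the free weight t is tuned in the growth bound
for m. -/
theorem norm_pairing_le (h : P.IsSolution lam y) (h₁ : P.IsSolution mu y₁) {t : ℝ} (ht : 0 < t) :
    ‖P.pairing y y₁‖ ≤ (t * P.normSq y + t⁻¹ * P.normSq y₁) / 2 := by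
  have key : ∀ (a b : ℝ) (f g : ℝ → ℂ), a ≤ b → ContinuousOn f (Icc a b) →
      ContinuousOn g (Icc a b) → ‖∫ x in a..b, f x * g x‖ ≤
        (t * (∫ x in a..b, ‖f x‖ ^ 2) + t⁻¹ * ∫ x in a..b, ‖g x‖ ^ 2) / 2 := by
    intro a b f g hab hf hg
    rw [← uIcc_of_le hab] at hf hg
    have hf' : IntervalIntegrable (fun x => ‖f x‖ ^ 2) volume a b :=
      (hf.norm.pow 2).intervalIntegrable
    have hg' : IntervalIntegrable (fun x => ‖g x‖ ^ 2) volume a b :=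
      (hg.norm.pow 2).intervalIntegrable
    rw [← intervalIntegral.integral_const_mul, ← intervalIntegral.integral_const_mul,
      ← intervalIntegral.integral_add (hf'.const_mul _) (hg'.const_mul _),
      ← intervalIntegral.integral_div]
    refine intervalIntegral.norm_integral_le_of_norm_le hab (.of_forall fun x _ => ?_)
      (((hf'.const_mul _).add (hg'.const_mul _)).div_const _)
    rw [norm_mul]
    have e : t * ‖f x‖ ^ 2 + t⁻¹ * ‖g x‖ ^ 2 - 2 * (‖f x‖ * ‖g x‖) =
        t⁻¹ * (t * ‖f x‖ - ‖g x‖) ^ 2 := by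
      field_simp; ring
    have e' : 0 ≤ t⁻¹ * (t * ‖f x‖ - ‖g x‖) ^ 2 := by positivity
    linarith
  have k1 := key (-P.S) 0 _ _ P.neg_S_le h.continuousOn_left h₁.continuousOn_left
  have k2 := key 0 P.S _ _ P.S_pos.le h.continuousOn_right h₁.continuousOn_right
  refine (norm_add_le _ _).trans ?_
  unfold normSq
  linarith

/-! ### The Weyl function and its growth -/

/-- The value of the Titchmarsh–Weyl function. -/
noncomputable def weyl (P : TransferProblem) (lam : ℂ) : ℂ := -(P.charU lam / P.charW lam)

/-- The Weyl solution `u_α + m w_α`. -/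
noncomputable def weylSol (P : TransferProblem) (lam : ℂ) : BrokenFun :=
  .comb 1 (P.solU lam) (P.weyl lam) (P.solW lam)

theorem isSolution_weylSol (P : TransferProblem) (lam : ℂ) : P.IsSolution lam (P.weylSol lam) :=
  (P.isU_solU lam).1.comb (P.isW_solW lam).1 _ _

theorem weylSol_left (P : TransferProblem) (lam : ℂ) :
    (P.weylSol lam).left (-P.S) = Real.cos P.α + P.weyl lam * Real.sin P.α := by
  simp only [weylSol, BrokenFun.comb, (P.isU_solU lam).2.1, (P.isW_solW lam).2.1, one_mul]

theorem weylSol_dleft (P : TransferProblem) (lam : ℂ) :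
    (P.weylSol lam).dleft (-P.S) = -Real.sin P.α + P.weyl lam * Real.cos P.α := by
  simp only [weylSol, BrokenFun.comb, (P.isU_solU lam).2.2, (P.isW_solW lam).2.2, one_mul]

theorem endForm_weylSol (h : P.charW lam ≠ 0) : P.endForm (P.weylSol lam) = 0 := by
  rw [weylSol, endForm_comb, weyl]
  change 1 * P.charU lam + -(P.charU lam / P.charW lam) * P.charW lam = 0
  field_simp
  ring

theorem isWeylFunction_weyl (P : TransferProblem) : P.IsWeylFunction P.weyl := by
  intro lam h z
  have h' : P.charW lam ≠ 0 := fun h0 => h (isEigenvalue_iff.2 h0)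
  rw [isWeylValue_iff, weyl, ← neg_div, eq_div_iff h']
  exact ⟨fun e => by linear_combination e, fun e => by linear_combination e⟩

/-- Lagrange's identity for two Weyl solutions: their Wronskian vanishes at S and equals m(μ) - m(λ)
at -S. -/
theorem weyl_sub_weyl (h : P.charW lam ≠ 0) (h₁ : P.charW mu ≠ 0) :
    P.weyl lam - P.weyl mu = (lam - mu) * P.pairing (P.weylSol lam) (P.weylSol mu) := by
  have e := (P.isSolution_weylSol lam).lagrange_pairing (P.isSolution_weylSol mu)
  rw [wronskian_end_eq_zero (endForm_weylSol h) (endForm_weylSol h₁), weylSol_left, weylSol_dleft,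
    weylSol_left, weylSol_dleft] at e
  linear_combination e - (P.weyl lam - P.weyl mu) * sin_sq_add_cos_sq_complex P.α

theorem im_weyl (h : P.charW lam ≠ 0) :
    (P.weyl lam).im = lam.im * P.normSq (P.weylSol lam) := by
  have e := (P.isSolution_weylSol lam).lagrange_normSq
  rw [im_end_eq_zero (endForm_weylSol h), weylSol_left, weylSol_dleft] at e
  rw [← e]
  simp only [map_add, map_mul, Complex.conj_ofReal, Complex.mul_im, Complex.add_re, Complex.add_im,
    Complex.neg_re, Complex.neg_im, Complex.mul_re, Complex.ofReal_re, Complex.ofReal_im,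
    Complex.conj_re, Complex.conj_im]
  linear_combination -(P.weyl lam).im * Real.sin_sq_add_cos_sq P.α

/-- Comparison with the fixed point i: the pairing is controlled by ‖ψ‖², and Im λ · ‖ψ‖² = Im m is
in turn controlled by m itself. -/
theorem exists_norm_weyl_mul_le (P : TransferProblem) :
    ∃ C, ∀ lam : ℂ, lam.im ≠ 0 → 1 ≤ ‖lam‖ → ‖P.weyl lam‖ * |lam.im| ≤ C * ‖lam‖ ^ 2 := by
  have hI : P.charW Complex.I ≠ 0 := charW_ne_zero_of_im_ne_zero (by simp)
  set mI := P.weyl Complex.I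
  set N := P.normSq (P.weylSol Complex.I)
  have hN : 0 ≤ N := P.normSq_nonneg _
  refine ⟨2 * ‖mI‖ + 4 * N, fun lam him h1 => ?_⟩
  have hL : P.charW lam ≠ 0 := charW_ne_zero_of_im_ne_zero him
  set D := ‖lam - Complex.I‖
  set b := |lam.im|
  have hb : 0 < b := abs_pos.2 him
  have hbl : b ≤ ‖lam‖ := Complex.abs_im_le_norm lam
  have hD : D ≤ 2 * ‖lam‖ := by
    refine (norm_sub_le _ _).trans ?_
    rw [Complex.norm_I]; linarith
  have hX : ‖P.weyl lam - mI‖ * b ≤ b * ‖mI‖ + D ^ 2 * N := by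
    rcases eq_or_ne lam Complex.I with rfl | hne
    · simp only [mI, sub_self, norm_zero, zero_mul]; positivity
    have hD0 : 0 < D := norm_pos_iff.2 (sub_ne_zero.2 hne)
    -- With weight b/D the unknown norm enters as b · |Im m| / 2, and half of the left-hand side
    -- absorbs it.
    have hp := norm_pairing_le (P.isSolution_weylSol lam) (P.isSolution_weylSol Complex.I)
      (div_pos hb hD0)
    have e : ‖P.weyl lam - mI‖ = D * ‖P.pairing (P.weylSol lam) (P.weylSol Complex.I)‖ := by
      rw [weyl_sub_weyl hL hI, norm_mul]
    have him' : b * P.normSq (P.weylSol lam) ≤ ‖P.weyl lam - mI‖ + ‖mI‖ := by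
      calc _ = |(P.weyl lam).im| := by
            rw [im_weyl hL, abs_mul, abs_of_nonneg (P.normSq_nonneg _)]
        _ ≤ ‖P.weyl lam‖ := Complex.abs_im_le_norm _
        _ = ‖P.weyl lam - mI + mI‖ := by rw [sub_add_cancel]
        _ ≤ _ := norm_add_le _ _
    have h2 : ‖P.weyl lam - mI‖ * b ≤ (b * (b * P.normSq (P.weylSol lam)) + D ^ 2 * N) / 2 := by
      rw [e]
      calc _ ≤ D * ((b / D * P.normSq (P.weylSol lam) + (b / D)⁻¹ * N) / 2) * b := by gcongr
        _ = _ := by field_simp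
    have h3 : b * (b * P.normSq (P.weylSol lam)) ≤ b * (‖P.weyl lam - mI‖ + ‖mI‖) := by gcongr
    nlinarith
  have h4 : ‖P.weyl lam‖ ≤ ‖P.weyl lam - mI‖ + ‖mI‖ := by
    simpa using norm_add_le (P.weyl lam - mI) mI
  calc ‖P.weyl lam‖ * b ≤ (‖P.weyl lam - mI‖ + ‖mI‖) * b := by gcongr
    _ ≤ 2 * (b * ‖mI‖) + D ^ 2 * N := by linarith
    _ ≤ 2 * (‖lam‖ ^ 2 * ‖mI‖) + (2 * ‖lam‖) ^ 2 * N := by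
        gcongr
        nlinarith
    _ = _ := by ring

end TransferProblem

/-! ### Complex analysis: removing the poles and bounding the difference -/

open scoped Topology
open Filter

/-- A function all of whose singularities are removable extends to an entire function. -/
theorem exists_entire_extension {f : ℂ → ℂ}
    (h : ∀ mu, ∃ g : ℂ → ℂ, AnalyticAt ℂ g mu ∧ f =ᶠ[𝓝[≠] mu] g) :
    ∃ E : ℂ → ℂ, Differentiable ℂ E ∧ ∀ mu, ContinuousAt f mu → E mu = f mu := by
  choose g hg hfg using h
  have hlim : ∀ mu, Tendsto f (𝓝[≠] mu) (𝓝 (g mu mu)) := fun mu =>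
    ((hg mu).continuousAt.tendsto.mono_left nhdsWithin_le_nhds).congr' (hfg mu).symm
  -- Each point takes the value of its own local extension; near mu these values agree with the
  -- single analytic function `g mu`.
  refine ⟨fun mu => g mu mu, fun mu => ?_, fun mu hc =>
    tendsto_nhds_unique (hlim mu) (hc.tendsto.mono_left nhdsWithin_le_nhds)⟩
  refine (hg mu).differentiableAt.congr_of_eventuallyEq ?_
  have h1 : ∀ᶠ lam in 𝓝[≠] mu, g lam lam = g mu lam := by
    filter_upwards [eventually_eventually_nhdsWithin.2 (hfg mu), self_mem_nhdsWithin,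
      nhdsWithin_le_nhds (hg mu).eventually_analyticAt] with lam h1 h2 h3
    have h4 : f =ᶠ[𝓝[≠] lam] g mu := by
      have : 𝓝[{mu}ᶜ] lam = 𝓝 lam :=
        isOpen_compl_singleton.nhdsWithin_eq h2
      rw [this] at h1
      exact nhdsWithin_le_nhds h1
    exact tendsto_nhds_unique (hlim lam)
      ((h3.continuousAt.tendsto.mono_left nhdsWithin_le_nhds).congr' h4.symm)
  have h2 := eventually_nhdsWithin_iff.1 h1
  filter_upwards [h2] with lam hlam
  rcases eq_or_ne lam mu with rfl | hne
  · rfl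
  · exact hlam hne

theorem analyticAt_dslope {f : ℂ → ℂ} (hf : Differentiable ℂ f) (mu lam : ℂ) :
    AnalyticAt ℂ (dslope f mu) lam := by
  have : DifferentiableOn ℂ (dslope f mu) univ :=
    (Complex.differentiableOn_dslope univ_mem).2 hf.differentiableOn
  exact this.analyticAt univ_mem

theorem differentiable_dslope {f : ℂ → ℂ} (hf : Differentiable ℂ f) (mu : ℂ) :
    Differentiable ℂ (dslope f mu) := fun lam => (analyticAt_dslope hf mu lam).differentiableAt

theorem eq_sub_mul_dslope {f : ℂ → ℂ} {mu : ℂ} (h : f mu = 0) (lam : ℂ) :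
    f lam = (lam - mu) * dslope f mu lam := by
  have := sub_smul_dslope f mu lam
  rw [h, sub_zero, smul_eq_mul] at this
  exact this.symm

/-- Two quotients of entire functions with the same simple poles and residues differ by an entire
function. -/
theorem exists_entire_eq_sub {U₁ W₁ U₂ W₂ a : ℂ → ℂ} (hU₁ : Differentiable ℂ U₁)
    (hW₁ : Differentiable ℂ W₁) (hU₂ : Differentiable ℂ U₂) (hW₂ : Differentiable ℂ W₂)
    (hzero : ∀ mu, W₁ mu = 0 ↔ W₂ mu = 0) (ha : ∀ mu, W₁ mu = 0 → a mu ≠ 0)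
    (hU₁0 : ∀ mu, W₁ mu = 0 → U₁ mu ≠ 0) (hU₂0 : ∀ mu, W₁ mu = 0 → U₂ mu ≠ 0)
    (hd₁ : ∀ mu, W₁ mu = 0 → HasDerivAt W₁ (a mu * U₁ mu) mu)
    (hd₂ : ∀ mu, W₁ mu = 0 → HasDerivAt W₂ (a mu * U₂ mu) mu) :
    ∃ E : ℂ → ℂ, Differentiable ℂ E ∧
      ∀ mu, W₁ mu ≠ 0 → E mu = U₁ mu / W₁ mu - U₂ mu / W₂ mu := by
  have hreg : ∀ mu, W₁ mu ≠ 0 → AnalyticAt ℂ (fun lam => U₁ lam / W₁ lam - U₂ lam / W₂ lam) mu :=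
    fun mu h => ((hU₁.analyticAt mu).fun_div (hW₁.analyticAt mu) h).fun_sub
      ((hU₂.analyticAt mu).fun_div (hW₂.analyticAt mu) (fun h' => h ((hzero mu).2 h')))
  obtain ⟨E, hE, hE'⟩ := exists_entire_extension
    (f := fun lam => U₁ lam / W₁ lam - U₂ lam / W₂ lam) (fun mu => by
    by_cases h : W₁ mu = 0
    swap
    · exact ⟨_, hreg mu h, .rfl⟩
    set g₁ := dslope W₁ mu
    set g₂ := dslope W₂ mu
    have e₁ := eq_sub_mul_dslope h
    have e₂ := eq_sub_mul_dslope ((hzero mu).1 h)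
    have v₁ : g₁ mu = a mu * U₁ mu := (dslope_same W₁ mu).trans (hd₁ mu h).deriv
    have v₂ : g₂ mu = a mu * U₂ mu := (dslope_same W₂ mu).trans (hd₂ mu h).deriv
    have n₁ : g₁ mu ≠ 0 := v₁ ▸ mul_ne_zero (ha mu h) (hU₁0 mu h)
    have n₂ : g₂ mu ≠ 0 := v₂ ▸ mul_ne_zero (ha mu h) (hU₂0 mu h)
    have hg₁ := differentiable_dslope hW₁ mu
    have hg₂ := differentiable_dslope hW₂ mu
    -- After factoring λ - μ out of both denominators, H is the remaining numerator. It vanishes at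
    -- μ exactly because the same a occurs in both derivatives.
    set H : ℂ → ℂ := fun lam => U₁ lam * g₂ lam - U₂ lam * g₁ lam
    have hH : Differentiable ℂ H := (hU₁.fun_mul hg₂).fun_sub (hU₂.fun_mul hg₁)
    have H0 : H mu = 0 := by simp only [H, v₁, v₂]; ring
    have eH := eq_sub_mul_dslope H0
    refine ⟨fun lam => dslope H mu lam / (g₁ lam * g₂ lam),
      (analyticAt_dslope hH mu mu).fun_div
        ((hg₁.analyticAt mu).fun_mul (hg₂.analyticAt mu)) (mul_ne_zero n₁ n₂), ?_⟩
    filter_upwards [self_mem_nhdsWithin,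
      nhdsWithin_le_nhds (hg₁.continuous.continuousAt.eventually_ne n₁),
      nhdsWithin_le_nhds (hg₂.continuous.continuousAt.eventually_ne n₂)] with lam hne hn₁ hn₂
    have hs : lam - mu ≠ 0 := sub_ne_zero.2 hne
    replace hn₁ : g₁ lam ≠ 0 := hn₁
    replace hn₂ : g₂ lam ≠ 0 := hn₂
    have eH' := eH lam
    simp only [H] at eH'
    rw [e₁ lam, e₂ lam]
    change _ / ((lam - mu) * g₁ lam) - _ / ((lam - mu) * g₂ lam) = _
    field_simp
    linear_combination eH')
  exact ⟨E, hE, fun mu h => hE' mu (hreg mu h).continuousAt⟩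

/-- An entire function with `|E z| |Im z| ≤ C |z|²` for large `z` is affine. -/
theorem exists_affine_of_norm_mul_abs_im_le {E : ℂ → ℂ} (hE : Differentiable ℂ E) {C : ℝ}
    (h : ∀ z : ℂ, z.im ≠ 0 → 1 ≤ ‖z‖ → ‖E z‖ * |z.im| ≤ C * ‖z‖ ^ 2) :
    ∃ A B : ℂ, ∀ z, E z = A + B * z := by
  -- On |z| = R the factor z² - R² has modulus 2R |Im z|, which compensates for the bound
  -- degenerating at the real axis.
  have hcirc : ∀ R : ℝ, 1 ≤ R → ∀ z : ℂ, ‖z‖ = R → ‖(z ^ 2 - R ^ 2) * E z‖ ≤ 2 * C * R ^ 3 := by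
    intro R hR z hz
    have hC : 0 ≤ C := by
      have := h Complex.I (by simp) (by simp)
      simp only [Complex.norm_I, Complex.I_im, abs_one, one_pow, mul_one] at this
      exact (norm_nonneg _).trans this
    have e1 : (R : ℂ) ^ 2 = z * conj z := by rw [Complex.mul_conj', hz]
    have e2 : z ^ 2 - (R : ℂ) ^ 2 = z * (2 * z.im * Complex.I) := by
      have := Complex.sub_conj z
      push_cast at this
      rw [e1]
      linear_combination z * this
    have e3 : ‖z ^ 2 - (R : ℂ) ^ 2‖ = 2 * R * |z.im| := by
      rw [e2]; simp [hz]; ring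
    rw [norm_mul, e3]
    by_cases him : z.im = 0
    · rw [him]; simp; positivity
    · have := h z him (hz ▸ hR)
      rw [hz] at this
      calc _ = 2 * R * (‖E z‖ * |z.im|) := by ring
        _ ≤ 2 * R * (C * R ^ 2) := by gcongr
        _ = _ := by ring
  have hgrow : ∀ z : ℂ, 1 ≤ ‖z‖ → ‖E z‖ ≤ 6 * C * ‖z‖ := by
    intro z hz
    set r := ‖z‖
    have hr : 0 < r := by linarith
    have hR : (2 * r) ≠ 0 := by positivity
    -- Maximum principle on the disc of radius 2r, where r = |z|: there |z² - 4r²| ≥ 3r², giving the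
    -- factor 16/3, rounded up to 6.
    have hmax := Complex.norm_le_of_forall_mem_frontier_norm_le
      (f := fun z => (z ^ 2 - ((2 * r : ℝ) : ℂ) ^ 2) * E z) (U := Metric.ball 0 (2 * r))
      Metric.isBounded_ball (Differentiable.diffContOnCl (by fun_prop))
      (C := 2 * C * (2 * r) ^ 3) (fun w hw => by
        rw [frontier_ball _ hR, mem_sphere_zero_iff_norm] at hw
        exact hcirc (2 * r) (by linarith) w hw)
      (z := z) (subset_closure (mem_ball_zero_iff.2 (by linarith)))
    have hlow : 3 * r ^ 2 ≤ ‖z ^ 2 - ((2 * r : ℝ) : ℂ) ^ 2‖ := by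
      have := norm_sub_norm_le (((2 * r : ℝ) : ℂ) ^ 2) (z ^ 2)
      rw [norm_sub_rev, norm_pow, norm_pow, Complex.norm_real, Real.norm_of_nonneg (by positivity)]
        at this
      change (2 * r) ^ 2 - r ^ 2 ≤ _ at this
      linarith
    rw [norm_mul] at hmax
    have h3 : 3 * r ^ 2 * ‖E z‖ ≤ 3 * r ^ 2 * (6 * C * r) := by
      calc _ ≤ ‖z ^ 2 - ((2 * r : ℝ) : ℂ) ^ 2‖ * ‖E z‖ := by gcongr
        _ ≤ 2 * C * (2 * r) ^ 3 := hmax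
        _ ≤ _ := by
          have : 0 ≤ C * r ^ 3 := by
            by_contra! hneg
            have : 0 ≤ 2 * C * (2 * r) ^ 3 := le_trans (by positivity) hmax
            nlinarith
          nlinarith
    exact le_of_mul_le_mul_left h3 (by positivity)
  have hds := differentiable_dslope hE 0
  -- Linear growth of E bounds its difference quotient at 0, to which Liouville's theorem applies.
  have hbdd : Bornology.IsBounded (range (dslope E 0)) := by
    obtain ⟨K, hK⟩ := (isCompact_closedBall (0 : ℂ) 1).exists_bound_of_continuousOn
      hds.continuous.continuousOn
    refine isBounded_iff_forall_norm_le.2 ⟨max K (6 * C + ‖E 0‖), ?_⟩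
    rintro _ ⟨z, rfl⟩
    rcases le_total ‖z‖ 1 with hz | hz
    · exact (hK z (mem_closedBall_zero_iff.2 hz)).trans (le_max_left _ _)
    · refine le_trans ?_ (le_max_right _ _)
      have hz0 : 0 < ‖z‖ := by linarith
      have e := congrArg norm (sub_smul_dslope E 0 z)
      rw [sub_zero, norm_smul] at e
      have h1 : ‖z‖ * ‖dslope E 0 z‖ ≤ ‖z‖ * (6 * C + ‖E 0‖) := by
        rw [e]
        refine (norm_sub_le _ _).trans ?_
        have := hgrow z hz
        have := mul_le_mul_of_nonneg_right hz (norm_nonneg (E 0))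
        linarith
      exact le_of_mul_le_mul_left h1 hz0
  refine ⟨E 0, dslope E 0 0, fun z => ?_⟩
  have e := sub_smul_dslope E 0 z
  rw [hds.apply_eq_apply_of_bounded hbdd z 0, sub_zero, smul_eq_mul] at e
  linear_combination -e

/-! ### Asymptotics on the positive imaginary axis -/

/-- If `Im (z ȳ) ≥ 0`, then `|z + k y| ≤ 3 |z - k y|` for `k = r (1 - i)`. -/
theorem norm_add_mul_le_three_mul {r : ℝ} {y z : ℂ} (hr : 0 < r) (h : 0 ≤ (z * conj y).im) :
    ‖z + r * (1 - Complex.I) * y‖ ≤ 3 * ‖z - r * (1 - Complex.I) * y‖ := by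
  refine (sq_le_sq₀ (norm_nonneg _) (by positivity)).1 ?_
  rw [mul_pow, ← Complex.normSq_eq_norm_sq, ← Complex.normSq_eq_norm_sq]
  simp only [Complex.normSq_apply, Complex.mul_im, Complex.mul_re, Complex.add_re, Complex.add_im,
    Complex.sub_re, Complex.sub_im, Complex.one_re, Complex.one_im, Complex.I_re, Complex.I_im,
    Complex.ofReal_re, Complex.ofReal_im, Complex.conj_re, Complex.conj_im] at h ⊢
  have h' := mul_nonneg hr.le h
  -- The difference of the two sides is 8|z - (5/4)ry|² + (7/2)r²|y|² + 20r Im(zȳ).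
  nlinarith [sq_nonneg (z.re - 5 / 4 * r * y.re), sq_nonneg (z.im - 5 / 4 * r * y.im),
    sq_nonneg (r * y.re), sq_nonneg (r * y.im)]

theorem norm_mul_one_sub_I {r : ℝ} (hr : 0 ≤ r) :
    r ≤ ‖(r : ℂ) * (1 - Complex.I)‖ ∧ ‖(r : ℂ) * (1 - Complex.I)‖ ≤ 2 * r := by
  have h1 : ‖(r : ℂ) * (1 - Complex.I)‖ = r * ‖1 - Complex.I‖ := by
    rw [norm_mul, Complex.norm_real, Real.norm_of_nonneg hr]
  have h2 : 1 ≤ ‖1 - Complex.I‖ := by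
    have := Complex.abs_re_le_norm (1 - Complex.I)
    simpa using this
  have h3 : ‖1 - Complex.I‖ ≤ 2 := by
    refine (norm_sub_le _ _).trans ?_
    rw [norm_one, Complex.norm_I]; norm_num
  rw [h1]
  constructor <;> nlinarith

/-- The exponentially weighted combination `e^{-k (x - a)} (z + k y)` of a solution with
`lam = -k²` is a primitive of `e^{-k (x - a)} q y`. -/
theorem SolvesOn.isPrimitiveOn_exp_mul {q : ℝ → ℝ} {lam k : ℂ} {a b : ℝ} {y z : ℝ → ℂ}
    (h : SolvesOn q lam a b y z) (hab : a ≤ b) (hq : IntervalIntegrable q volume a b)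
    (hk : lam = -k ^ 2) :
    IsPrimitiveOn (fun x => Complex.exp (-k * (x - a)) * (z x + k * y x))
      (fun x => Complex.exp (-k * (x - a)) * (q x * y x)) a b := by
  have hexp : IsPrimitiveOn (fun x : ℝ => Complex.exp (-k * (x - a)))
      (fun x : ℝ => Complex.exp (-k * (x - a)) * -k) a b := by
    refine .of_hasDerivWithinAt hab (fun x _ => ?_) (by fun_prop)
    have h1 : HasDerivAt (fun x : ℝ => -k * ((x : ℂ) - a)) (-k * 1) x :=
      (((hasDerivAt_id x).ofReal_comp).sub_const (a : ℂ)).const_mul (-k)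
    rw [mul_one] at h1
    exact h1.cexp.hasDerivWithinAt
  have h2 := hexp.mul ((h.isPrimitiveOn_deriv hab hq).add
    ((h.isPrimitiveOn hab hq).const_mul k) hab) hab
  convert h2 using 2 with x
  rw [hk]
  ring

/-- With f = y' + ky and g = y' - ky, the sign condition keeps f and y controlled by g. The estimate
then says that y' is nearly -ky at a, with an error coefficient tending to zero after multiplication
by r. -/
theorem SolvesOn.norm_add_mul_le {q : ℝ → ℝ} {lam : ℂ} {a b r : ℝ} {y z : ℝ → ℂ}
    (h : SolvesOn q lam a b y z) (hab : a ≤ b) (hq : IntervalIntegrable q volume a b)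
    (hr : 0 < r) (hlam : lam = 2 * Complex.I * r ^ 2)
    (him : ∀ x ∈ Icc a b, 0 ≤ (z x * conj (y x)).im)
    (hrq : 4 * (∫ t in a..b, |q t|) ≤ r) :
    r * ‖z a + r * (1 - Complex.I) * y a‖ ≤
      (6 * (r * Real.exp (-r * (b - a))) + 4 * ∫ t in a..b, Real.exp (-r * (t - a)) * |q t|) *
        ‖z a - r * (1 - Complex.I) * y a‖ := by
  set k : ℂ := r * (1 - Complex.I) with hkdef
  have hk2 : lam = -k ^ 2 := by
    rw [hlam, hkdef, mul_pow, sub_sq, Complex.I_sq]; ring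
  have hkr : r ≤ ‖k‖ := (norm_mul_one_sub_I hr.le).1
  have hexp : ∀ t : ℝ, ‖Complex.exp (-k * (t - a))‖ = Real.exp (-r * (t - a)) := fun t => by
    rw [Complex.norm_exp]; simp [hkdef]
  have hexp' : ∀ t : ℝ, ‖Complex.exp (-(-k) * (t - a))‖ = Real.exp (r * (t - a)) := fun t => by
    rw [Complex.norm_exp]; simp [hkdef]
  set f : ℝ → ℂ := fun x => z x + k * y x
  set g : ℝ → ℂ := fun x => z x - k * y x
  have hfg : ∀ x ∈ Icc a b, ‖f x‖ ≤ 3 * ‖g x‖ := fun x hx =>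
    norm_add_mul_le_three_mul hr (him x hx)
  have hy : ∀ x ∈ Icc a b, r * ‖y x‖ ≤ 2 * ‖g x‖ := fun x hx => by
    have e : 2 * (k * y x) = f x - g x := by simp only [f, g]; ring
    have e1 := congrArg norm e
    rw [norm_mul, norm_mul, Complex.norm_ofNat] at e1
    have e2 := norm_sub_le (f x) (g x)
    have e3 := hfg x hx
    have e4 := mul_le_mul_of_nonneg_right hkr (norm_nonneg (y x))
    linarith
  have hgc : ContinuousOn g (Icc a b) :=
    ((h.isPrimitiveOn_deriv hab hq).continuousOn hab).sub (continuousOn_const.mul h.continuousOn)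
  obtain ⟨x₀, hx₀, hmax⟩ := isCompact_Icc.exists_isMaxOn (nonempty_Icc.2 hab) hgc.norm
  set G := ‖g x₀‖
  have hG : ∀ x ∈ Icc a b, ‖g x‖ ≤ G := fun x hx => hmax hx
  have hyG : ∀ x ∈ Icc a b, ‖y x‖ ≤ 2 * G / r := fun x hx => by
    rw [le_div_iff₀ hr]
    linarith [hy x hx, hG x hx]
  have hQ : 0 ≤ ∫ t in a..b, |q t| := intervalIntegral.integral_nonneg hab fun _ _ => abs_nonneg _
  have hma : a ∈ Icc a b := left_mem_Icc.2 hab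
  have hmb : b ∈ Icc a b := right_mem_Icc.2 hab
  -- The growing weight links g at a to its maximum; `hrq` makes the contribution of q at most G/2.
  have hG2 : G ≤ 2 * ‖g a‖ := by
    have hp := (h.isPrimitiveOn_exp_mul (k := -k) hab hq (by rw [hk2]; ring)).sub_eq hab hma hx₀
    have hb : ‖∫ t in a..x₀, Complex.exp (-(-k) * (t - a)) * (q t * y t)‖ ≤
        ∫ t in a..x₀, (Real.exp (r * (x₀ - a)) * (2 * G / r)) * |q t| := by
      refine intervalIntegral.norm_integral_le_of_norm_le hx₀.1 (.of_forall fun t ht => ?_)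
        ((hq.abs.mono_set (uIcc_subset_uIcc left_mem_uIcc (by rwa [uIcc_of_le hab]))).const_mul _)
      rw [norm_mul, hexp', norm_mul, Complex.norm_real, Real.norm_eq_abs]
      have h1 : Real.exp (r * (t - a)) ≤ Real.exp (r * (x₀ - a)) := by gcongr; exact ht.2
      have h2 := hyG t ⟨ht.1.le, ht.2.trans hx₀.2⟩
      calc _ ≤ Real.exp (r * (x₀ - a)) * (|q t| * (2 * G / r)) := by gcongr
        _ = _ := by ring
    rw [intervalIntegral.integral_const_mul] at hb
    have hmono : ∫ t in a..x₀, |q t| ≤ ∫ t in a..b, |q t| :=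
      intervalIntegral.integral_mono_interval le_rfl hx₀.1 hx₀.2
        (.of_forall fun t => abs_nonneg _) hq.abs
    have hE : 1 ≤ Real.exp (r * (x₀ - a)) :=
      Real.one_le_exp (mul_nonneg hr.le (sub_nonneg.2 hx₀.1))
    have e : Complex.exp (-(-k) * (x₀ - a)) * g x₀ = g a +
        ∫ t in a..x₀, Complex.exp (-(-k) * (t - a)) * (q t * y t) := by
      rw [← hp]
      simp only [g, sub_self, mul_zero, Complex.exp_zero, one_mul]
      ring
    have e' := congrArg norm e
    rw [norm_mul, hexp'] at e'
    have h3 : Real.exp (r * (x₀ - a)) * G ≤ Real.exp (r * (x₀ - a)) * (‖g a‖ + G / 2) := by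
      change Real.exp (r * (x₀ - a)) * ‖g x₀‖ ≤ _
      rw [e']
      calc _ ≤ ‖g a‖ + Real.exp (r * (x₀ - a)) * (2 * G / r) * ∫ t in a..x₀, |q t| :=
            (norm_add_le _ _).trans (by gcongr)
        _ ≤ Real.exp (r * (x₀ - a)) * ‖g a‖ + Real.exp (r * (x₀ - a)) * (2 * G / r) * (r / 4) := by
            gcongr
            · exact le_mul_of_one_le_left (norm_nonneg _) hE
            · linarith
        _ = _ := by field_simp; ring
    have := le_of_mul_le_mul_left h3 (Real.exp_pos _)
    linarith
  -- The decaying weight expresses f(a) through f(b), which is exponentially damped.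
  have hp := (h.isPrimitiveOn_exp_mul (k := k) hab hq hk2).sub_eq hab hma hmb
  have hint : IntervalIntegrable (fun t => Real.exp (-r * (t - a)) * |q t|) volume a b :=
    hq.abs.continuousOn_mul (by fun_prop)
  have hb : ‖∫ t in a..b, Complex.exp (-k * (t - a)) * (q t * y t)‖ ≤
      ∫ t in a..b, (2 * G / r) * (Real.exp (-r * (t - a)) * |q t|) := by
    refine intervalIntegral.norm_integral_le_of_norm_le hab (.of_forall fun t ht => ?_)
      (hint.const_mul _)
    rw [norm_mul, hexp, norm_mul, Complex.norm_real, Real.norm_eq_abs]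
    have h2 := hyG t ⟨ht.1.le, ht.2⟩
    calc _ ≤ Real.exp (-r * (t - a)) * (|q t| * (2 * G / r)) := by gcongr
      _ = _ := by ring
  rw [intervalIntegral.integral_const_mul] at hb
  set J := ∫ t in a..b, Real.exp (-r * (t - a)) * |q t|
  have hJ : 0 ≤ J := intervalIntegral.integral_nonneg hab fun _ _ => by positivity
  have e : f a = Complex.exp (-k * (b - a)) * f b -
      ∫ t in a..b, Complex.exp (-k * (t - a)) * (q t * y t) := by
    rw [← hp]
    simp only [f, sub_self, mul_zero, Complex.exp_zero, one_mul]
    ring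
  have hf : ‖f a‖ ≤ Real.exp (-r * (b - a)) * (3 * G) + 2 * G / r * J := by
    rw [e]
    refine (norm_sub_le _ _).trans ?_
    rw [norm_mul, hexp]
    have := (hfg b hmb).trans (mul_le_mul_of_nonneg_left (hG b hmb) (by norm_num : (0 : ℝ) ≤ 3))
    gcongr
  calc r * ‖f a‖ ≤ r * (Real.exp (-r * (b - a)) * (3 * G) + 2 * G / r * J) := by gcongr
    _ = (3 * (r * Real.exp (-r * (b - a))) + 2 * J) * G := by field_simp
    _ ≤ (3 * (r * Real.exp (-r * (b - a))) + 2 * J) * (2 * ‖g a‖) := by gcongr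
    _ = _ := by ring

/-- Dominated convergence handles the integral: for t > a the weight tends to zero, so no regularity
of q at the endpoint is needed. -/
theorem tendsto_exp_weight_zero {q : ℝ → ℝ} {a b : ℝ} (hab : a < b)
    (hq : IntervalIntegrable q volume a b) :
    Tendsto (fun r : ℝ => 6 * (r * Real.exp (-r * (b - a))) +
      4 * ∫ t in a..b, Real.exp (-r * (t - a)) * |q t|) atTop (𝓝 0) := by
  have h1 : Tendsto (fun r : ℝ => r * Real.exp (-r * (b - a))) atTop (𝓝 0) := by
    have hba : 0 < b - a := sub_pos.2 hab
    have := (Real.tendsto_pow_mul_exp_neg_atTop_nhds_zero 1).comp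
      (tendsto_id.atTop_mul_const hba)
    have h2 := this.const_mul (b - a)⁻¹
    rw [mul_zero] at h2
    refine h2.congr fun r => ?_
    simp only [Function.comp, id, pow_one]
    field_simp
  have h2 : Tendsto (fun r : ℝ => ∫ t in a..b, Real.exp (-r * (t - a)) * |q t|) atTop
      (𝓝 (∫ _ in a..b, (0 : ℝ))) := by
    refine intervalIntegral.tendsto_integral_filter_of_dominated_convergence (fun t => |q t|)
      (.of_forall fun r => ?_) ?_ hq.abs (.of_forall fun t ht => ?_)
    · have hc : Continuous fun t : ℝ => Real.exp (-r * (t - a)) := by fun_prop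
      exact hc.aestronglyMeasurable.mul hq.abs.def'.aestronglyMeasurable
    · filter_upwards [eventually_ge_atTop 0] with r hr
      refine .of_forall fun t ht => ?_
      rw [uIoc_of_le hab.le] at ht
      rw [norm_mul, Real.norm_eq_abs, Real.norm_eq_abs, Real.abs_exp, abs_abs]
      refine mul_le_of_le_one_left (abs_nonneg _) (Real.exp_le_one_iff.2 ?_)
      nlinarith [ht.1]
    · rw [uIoc_of_le hab.le] at ht
      have h3 : Tendsto (fun r : ℝ => Real.exp (-r * (t - a))) atTop (𝓝 0) := by
        refine Real.tendsto_exp_atBot.comp ?_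
        simp only [neg_mul]
        exact tendsto_neg_atTop_atBot.comp (tendsto_id.atTop_mul_const (sub_pos.2 ht.1))
      simpa using h3.mul_const |q t|
  simpa using (h1.const_mul 6).add (h2.const_mul 4)

/-- An affine expression in an unbounded quantity vanishes asymptotically only if it is zero. -/
theorem eq_zero_of_tendsto_affine {φ : ℝ → ℂ} {A B : ℂ}
    (hφ : Tendsto (fun r => (φ r)⁻¹) atTop (𝓝 0)) (hne : ∀ᶠ r in atTop, φ r ≠ 0)
    (h : Tendsto (fun r => A + B * φ r) atTop (𝓝 0)) : A = 0 ∧ B = 0 := by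
  have h1 := (h.mul hφ).sub (hφ.const_mul A)
  have hB : B = 0 := by
    refine tendsto_nhds_unique (f := fun _ : ℝ => B) (l := atTop) tendsto_const_nhds ?_
    simp only [mul_zero, sub_zero] at h1
    refine h1.congr' ?_
    filter_upwards [hne] with r hr
    field_simp
    ring
  subst hB
  simp only [zero_mul, add_zero] at h
  exact ⟨tendsto_nhds_unique tendsto_const_nhds h, rfl⟩

namespace TransferProblem

variable {P : TransferProblem}

/-- Asymptotics of the Weyl solution at the left endpoint along the positive imaginary axis. -/
theorem tendsto_weyl_asymptotics (hα : P.α ≠ 0) :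
    Tendsto (fun r : ℝ => (P.weyl (2 * Complex.I * r ^ 2) + Real.cos P.α / Real.sin P.α)⁻¹ -
      (Real.sin P.α * Real.cos P.α + Real.sin P.α ^ 2 * (r * (1 - Complex.I)))) atTop (𝓝 0) := by
  have hs : 0 < Real.sin P.α :=
    Real.sin_pos_of_pos_of_lt_pi (lt_of_le_of_ne P.α_mem.1 hα.symm) P.α_mem.2
  have hsc : (Real.sin P.α : ℂ) ≠ 0 := by exact_mod_cast hs.ne'
  have hlim := tendsto_exp_weight_zero (neg_lt_zero.2 P.S_pos) P.intervalIntegrable_q_left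
  set ε : ℝ → ℝ := fun r : ℝ => 6 * (r * Real.exp (-r * (0 - -P.S))) +
      4 * ∫ t in (-P.S)..0, Real.exp (-r * (t - -P.S)) * |P.q t|
  refine squeeze_zero_norm' (a := fun r => Real.sin P.α ^ 2 * (8 * ε r)) ?_ (by
    simpa using (hlim.const_mul 8).const_mul (Real.sin P.α ^ 2))
  filter_upwards [eventually_ge_atTop 1, eventually_ge_atTop (4 * ∫ t in (-P.S)..0, |P.q t|),
    hlim.eventually_le_const (by norm_num : (0 : ℝ) < 1 / 2)] with r h1 hrq hε
  have hr : 0 < r := by linarith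
  set lam : ℂ := 2 * Complex.I * r ^ 2 with hlam
  have himlam : lam.im = 2 * r ^ 2 := by
    have e : lam = ((2 * r ^ 2 : ℝ) : ℂ) * Complex.I := by rw [hlam]; push_cast; ring
    rw [e, Complex.mul_I_im, Complex.ofReal_re]
  have hW : P.charW lam ≠ 0 := charW_ne_zero_of_im_ne_zero (by rw [himlam]; positivity)
  have hsol := P.isSolution_weylSol lam
  have him : ∀ x ∈ Icc (-P.S) 0,
      0 ≤ ((P.weylSol lam).dleft x * conj ((P.weylSol lam).left x)).im := fun x hx => by
    have e := hsol.lagrange_im hx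
    rw [im_end_eq_zero (endForm_weylSol hW), sub_zero, himlam] at e
    rw [e]
    have i1 : 0 ≤ ∫ t in x..0, ‖(P.weylSol lam).left t‖ ^ 2 :=
      intervalIntegral.integral_nonneg hx.2 fun _ _ => by positivity
    have i2 : 0 ≤ ∫ t in (0 : ℝ)..P.S, ‖(P.weylSol lam).right t‖ ^ 2 :=
      intervalIntegral.integral_nonneg P.S_pos.le fun _ _ => by positivity
    positivity
  have hkey := hsol.1.norm_add_mul_le P.neg_S_le P.intervalIntegrable_q_left hr hlam him hrq
  rw [weylSol_left, weylSol_dleft] at hkey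
  change _ ≤ ε r * _ at hkey
  set s : ℂ := (Real.sin P.α : ℂ)
  set c : ℂ := (Real.cos P.α : ℂ)
  set m := P.weyl lam
  set k : ℂ := r * (1 - Complex.I)
  have hk2 : ‖k‖ ≤ 2 * r := (norm_mul_one_sub_I hr.le).2
  have hcs : s * s + c * c = 1 := sin_sq_add_cos_sq_complex P.α
  have hε0 : 0 ≤ ε r := by
    have : 0 ≤ ∫ t in (-P.S)..0, Real.exp (-r * (t - -P.S)) * |P.q t| :=
      intervalIntegral.integral_nonneg P.neg_S_le fun _ _ => by positivity
    positivity
  -- Bound g(a) by f(a) plus 4r|ψ(-S)|; since ε ≤ 1/2 ≤ r/2, the resulting f(a) term is absorbed on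
  -- the left.
  have hmain : ‖(-s + m * c) + k * (c + m * s)‖ ≤ 8 * ε r * ‖c + m * s‖ := by
    have e : (-s + m * c) - k * (c + m * s) =
        ((-s + m * c) + k * (c + m * s)) - 2 * (k * (c + m * s)) := by ring
    have e1 : ‖(-s + m * c) - k * (c + m * s)‖ ≤ ‖(-s + m * c) + k * (c + m * s)‖ +
        4 * r * ‖c + m * s‖ := by
      rw [e]
      refine (norm_sub_le _ _).trans ?_
      rw [norm_mul, norm_mul, Complex.norm_ofNat]
      have := mul_le_mul_of_nonneg_right hk2 (norm_nonneg (c + m * s))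
      linarith
    have e2 := hkey.trans (mul_le_mul_of_nonneg_left e1 hε0)
    set F := ‖(-s + m * c) + k * (c + m * s)‖
    have hF : 0 ≤ F := norm_nonneg _
    have e3 : ε r * F ≤ r / 2 * F := by
      gcongr
      linarith
    have e4 : r * F ≤ r * (8 * ε r * ‖c + m * s‖) := by linarith
    exact le_of_mul_le_mul_left e4 hr
  -- Were ψ(-S) zero, the estimate would force ψ'(-S) = 0 as well, but the initial data of ψ never
  -- both vanish.
  have hY : c + m * s ≠ 0 := by
    intro h0
    rw [h0] at hmain
    simp only [mul_zero, add_zero, norm_zero, norm_le_zero_iff] at hmain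
    have : (1 : ℂ) = 0 := by linear_combination c * h0 - s * hmain - hcs
    exact one_ne_zero this
  have hD : m + c / s = (c + m * s) / s := by field_simp; ring
  have e : (m + c / s)⁻¹ - (s * c + s ^ 2 * k) =
      -(s ^ 2 * (((-s + m * c) + k * (c + m * s)) / (c + m * s))) := by
    rw [hD]
    field_simp
    linear_combination -hcs
  rw [e, norm_neg, norm_mul, norm_pow, norm_div]
  have hns : ‖s‖ = Real.sin P.α := by
    rw [Complex.norm_real, Real.norm_of_nonneg hs.le]
  rw [hns]
  gcongr
  rw [div_le_iff₀ (norm_pos_iff.2 hY)]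
  exact hmain

end TransferProblem

/-! ### Uniqueness of the m-function -/

namespace TransferProblem

variable {P Q : TransferProblem}

theorem tendsto_inv_mul_one_sub_I :
    Tendsto (fun r : ℝ => ((r : ℂ) * (1 - Complex.I))⁻¹) atTop (𝓝 0) := by
  refine squeeze_zero_norm' (a := fun r : ℝ => r⁻¹) ?_ tendsto_inv_atTop_zero
  filter_upwards [eventually_gt_atTop 0] with r hr
  rw [norm_inv]
  exact inv_anti₀ hr (norm_mul_one_sub_I hr.le).1

theorem one_sub_I_mul_ne_zero {r : ℝ} (hr : 0 < r) : (r : ℂ) * (1 - Complex.I) ≠ 0 :=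
  norm_pos_iff.1 (hr.trans_le (norm_mul_one_sub_I hr.le).1)

theorem sin_complex_ne_zero (hα : P.α ≠ 0) : (Real.sin P.α : ℂ) ≠ 0 := by
  exact_mod_cast
    (Real.sin_pos_of_pos_of_lt_pi (lt_of_le_of_ne P.α_mem.1 hα.symm) P.α_mem.2).ne'

/-- Along the positive imaginary axis the Weyl function tends to `-cot α`. -/
theorem tendsto_weyl_add_cot (hα : P.α ≠ 0) :
    Tendsto (fun r : ℝ => P.weyl (2 * Complex.I * r ^ 2) + Real.cos P.α / Real.sin P.α)
      atTop (𝓝 0) := by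
  set D : ℝ → ℂ := fun r => P.weyl (2 * Complex.I * r ^ 2) + Real.cos P.α / Real.sin P.α
  have hs := sin_complex_ne_zero hα
  -- Dividing the expansion by k leaves the limit sin² α, nonzero because α ≠ 0; hence m + cot α is
  -- of order 1/k.
  have h1 := (tendsto_weyl_asymptotics hα).mul tendsto_inv_mul_one_sub_I
  have h2 := (h1.add (tendsto_inv_mul_one_sub_I.const_mul
    ((Real.sin P.α : ℂ) * Real.cos P.α))).add_const ((Real.sin P.α : ℂ) ^ 2)
  simp only [mul_zero, add_zero, zero_add] at h2
  have h3 : Tendsto (fun r => (D r)⁻¹ * ((r : ℂ) * (1 - Complex.I))⁻¹) atTop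
      (𝓝 ((Real.sin P.α : ℂ) ^ 2)) := by
    refine h2.congr' ?_
    filter_upwards [eventually_gt_atTop 0] with r hr
    have hk := mul_inv_cancel₀ (one_sub_I_mul_ne_zero hr)
    change ((D r)⁻¹ - _) * _ + _ + _ = (D r)⁻¹ * _
    generalize (r : ℂ) * (1 - Complex.I) = k at hk ⊢
    generalize D r = d
    linear_combination (-(Real.sin P.α : ℂ) ^ 2) * hk
  have h4 := (h3.inv₀ (pow_ne_zero 2 hs)).mul tendsto_inv_mul_one_sub_I
  rw [mul_zero] at h4
  refine h4.congr' ?_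
  filter_upwards [eventually_gt_atTop 0] with r hr
  have := one_sub_I_mul_ne_zero hr
  rw [mul_inv, inv_inv, inv_inv, mul_assoc, mul_inv_cancel₀ this, mul_one]

/-- Weyl functions with the same poles and residues coincide away from the poles. -/
theorem weyl_eq_weyl (hP : P.α ≠ 0) (hQ : Q.α ≠ 0)
    (hzero : ∀ mu, P.charW mu = 0 ↔ Q.charW mu = 0)
    (hnorm : ∀ mu, P.charW mu = 0 →
      P.pairing (P.solW mu) (P.solW mu) = Q.pairing (Q.solW mu) (Q.solW mu))
    {lam : ℂ} (hlam : P.charW lam ≠ 0) : P.weyl lam = Q.weyl lam := by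
  obtain ⟨E, hE, hEeq⟩ := exists_entire_eq_sub (a := fun mu => P.pairing (P.solW mu) (P.solW mu))
    P.differentiable_charU P.differentiable_charW Q.differentiable_charU Q.differentiable_charW
    hzero (fun mu h => pairing_solW_ne_zero h) (fun mu h => charU_ne_zero h)
    (fun mu h => charU_ne_zero ((hzero mu).1 h)) (fun mu h => hasDerivAt_charW h)
    (fun mu h => by
      simp only [hnorm mu h]
      exact hasDerivAt_charW ((hzero mu).1 h))
  have hEw : ∀ mu, P.charW mu ≠ 0 → E mu = Q.weyl mu - P.weyl mu := fun mu h => by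
    rw [hEeq mu h, weyl, weyl]; ring
  obtain ⟨C₁, hC₁⟩ := exists_norm_weyl_mul_le P
  obtain ⟨C₂, hC₂⟩ := exists_norm_weyl_mul_le Q
  obtain ⟨A, B, hAB⟩ := exists_affine_of_norm_mul_abs_im_le hE (C := C₂ + C₁) (fun z hz h1 => by
    rw [hEw z (charW_ne_zero_of_im_ne_zero hz), add_mul]
    refine le_trans ?_ (add_le_add (hC₂ z hz h1) (hC₁ z hz h1))
    rw [← add_mul]
    gcongr
    exact norm_sub_le _ _)
  set φ : ℝ → ℂ := fun r => 2 * Complex.I * r ^ 2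
  have hφim : ∀ r : ℝ, 0 < r → (φ r).im ≠ 0 := fun r hr => by
    have e : φ r = ((2 * r ^ 2 : ℝ) : ℂ) * Complex.I := by simp only [φ]; push_cast; ring
    rw [e, Complex.mul_I_im, Complex.ofReal_re]
    positivity
  have hφ0 : ∀ᶠ r in atTop, φ r ≠ 0 := by
    filter_upwards [eventually_gt_atTop 0] with r hr h0
    exact hφim r hr (by rw [h0, Complex.zero_im])
  have hφ : Tendsto (fun r => (φ r)⁻¹) atTop (𝓝 0) := by
    have := (tendsto_inv_mul_one_sub_I.mul tendsto_inv_mul_one_sub_I).neg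
    rw [mul_zero, neg_zero] at this
    refine this.congr fun r => ?_
    rw [← mul_inv, ← inv_neg]
    congr 1
    simp only [φ]
    linear_combination (-(r : ℂ) ^ 2) * Complex.I_sq
  set tP : ℂ := Real.cos P.α / Real.sin P.α with htP
  set tQ : ℂ := Real.cos Q.α / Real.sin Q.α with htQ
  have hdiff : ∀ r : ℝ, 0 < r →
      (Q.weyl (φ r) + tQ) - (P.weyl (φ r) + tP) = (A + (tQ - tP)) + B * φ r := fun r hr => by
    have := hEw (φ r) (charW_ne_zero_of_im_ne_zero (hφim r hr))
    rw [hAB] at this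
    linear_combination -this
  have hlim : Tendsto (fun r => (A + (tQ - tP)) + B * φ r) atTop (𝓝 0) := by
    have := (tendsto_weyl_add_cot hQ).sub (tendsto_weyl_add_cot hP)
    rw [sub_zero] at this
    refine this.congr' ?_
    filter_upwards [eventually_gt_atTop 0] with r hr
    exact hdiff r hr
  obtain ⟨hA, hB⟩ := eq_zero_of_tendsto_affine hφ hφ0 hlim
  have hsP := sin_complex_ne_zero hP
  have hsQ := sin_complex_ne_zero hQ
  have hlim2 := (tendsto_weyl_asymptotics hP).sub (tendsto_weyl_asymptotics hQ)
  rw [sub_zero] at hlim2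
  -- Now m + cot α is common to both problems on the ray, so subtracting the expansions leaves an
  -- affine expression in k that tends to zero.
  obtain ⟨h1, h2⟩ := eq_zero_of_tendsto_affine (φ := fun r : ℝ => (r : ℂ) * (1 - Complex.I))
    (A := Real.sin Q.α * Real.cos Q.α - Real.sin P.α * Real.cos P.α)
    (B := (Real.sin Q.α : ℂ) ^ 2 - (Real.sin P.α : ℂ) ^ 2) tendsto_inv_mul_one_sub_I
    ((eventually_gt_atTop 0).mono fun r hr => one_sub_I_mul_ne_zero hr) (by
      refine hlim2.congr' ?_
      filter_upwards [eventually_gt_atTop 0] with r hr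
      have e := hdiff r hr
      rw [hA, hB, zero_mul, add_zero, sub_eq_zero] at e
      simp only [φ, htP, htQ] at e
      rw [e]
      ring)
  -- Write cot α as sin α cos α / sin² α, both of which have been matched.
  have ht : tQ = tP := by
    rw [htQ, htP, ← mul_div_mul_left (Real.cos Q.α : ℂ) _ hsQ, ← mul_div_mul_left
      (Real.cos P.α : ℂ) _ hsP, ← sq, ← sq, sub_eq_zero.1 h1, sub_eq_zero.1 h2]
  rw [ht, sub_self, add_zero] at hA
  have := hEw lam hlam
  rw [hAB, hA, hB, zero_mul, add_zero] at this
  exact (sub_eq_zero.1 this.symm).symm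

end TransferProblem

theorem theorem3p2 (P Q : TransferProblem) (hP : P.α ≠ 0) (hQ : Q.α ≠ 0)
    (hspec : ∀ lam : ℂ, P.IsEigenvalue lam ↔ Q.IsEigenvalue lam)
    (hnorm : ∀ lam : ℂ, P.IsEigenvalue lam →
      ∀ a : ℂ, P.IsNormingConstant lam a ↔ Q.IsNormingConstant lam a) :
    ∃ m : ℂ → ℂ, P.IsWeylFunction m ∧ Q.IsWeylFunction m := by
  -- One function serving both problems encodes well-definedness and equality together, as
  -- `IsWeylFunction` includes uniqueness of the value.
  refine ⟨P.weyl, P.isWeylFunction_weyl, fun lam hlam z => ?_⟩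
  rw [Q.isWeylFunction_weyl lam hlam z, TransferProblem.weyl_eq_weyl hP hQ
    (fun mu => by rw [← TransferProblem.isEigenvalue_iff, hspec, TransferProblem.isEigenvalue_iff])
    (fun mu h => ?_)
    (fun h => hlam ((hspec lam).1 (TransferProblem.isEigenvalue_iff.2 h)))]
  exact TransferProblem.isNormingConstant_iff.1
    ((hnorm mu (TransferProblem.isEigenvalue_iff.2 h) _).1
      (TransferProblem.isNormingConstant_iff.2 rfl))
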